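/- \textbf{Model.} Let $\mathsf X$ be a Polish space with its Borel $\sigma$-field, $\nu$ a $\sigma$-finite measure on $\mathsf X$, $\chi$ a probability measure on $\mathsf X$, $q(x,x')\ge 0$ a jointly measurable transition density with respect to $\nu$ (so $\int q(x,x')\,\nu(dx')=1$ for all $x$), and $g_t:\mathsf X\to[0,\infty)$, $t\ge 0$, measurable functions (the likelihoods of the fixed observations). For $0\le s\le T$ the marginal smoothing distribution $\phi_{s|T}$ is the law of $x_s$ under the probability measure on $\mathsf X^{T+1}$ proportional to $$\chi(dx_0)\,g_0(x_0)\prod_{u=1}^T q(x_{u-1},x_u)\,g_u(x_u)\,\nu(dx_u).$$ \textbf{Auxiliary particle filter.} Let $\rho_0$ be a probability measure with $\chi\ll\rho_0$, and for $t\ge1$ let $\vartheta_t:\mathsf X\to(0,\infty)$ be measurable and $p_t(x,x')\ge 0$ be a jointly measurable transition density with respect to $\nu$ such that, for every $x$, $q(x,x')g_t(x')=0$ for $\nu$-almost every $x'$ with $p_t(x,x')=0$. Put $$\omega_0(x)=\frac{d\chi}{d\rho_0}(x)\,g_0(x),\qquad \omega_t(x,x')=\frac{q(x,x')\,g_t(x')}{\vartheta_t(x)\,p_t(x,x')}\quad(t\ge1),$$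 where $\omega_t(x,x')$ is set to $0$ if $p_t(x,x')=0$. With $N\ge 1$ particles, $\xi_0^1,\dots,\xi_0^N$ are i.i.d. with law $\rho_0$ and $\omega_0^i=\omega_0(\xi_0^i)$. For $t\ge1$, given $\mathcal F_{t-1}=\sigma\{(\xi_u^i,\omega_u^i):u\le t-1,\ 1\le i\le N\}$, the pairs $(I_t^i,\xi_t^i)$, $1\le i\le N$, are i.i.d. with law on $\{1,\dots,N\}\times\mathsf X$ proportional to $\omega_{t-1}^i\,\vartheta_t(\xi_{t-1}^i)\,p_t(\xi_{t-1}^i,x)\,\nu(dx)$, and $\omega_t^i=\omega_t(\xi_{t-1}^{I_t^i},\xi_t^i)$. Let $\Omega_t=\sum_{i=1}^N\omega_t^i$ and let $\mathcal A_T=\{\Omega_u>0\text{ for all }u\le T\}$ be the event that the weights do not all vanish at some time up to $T$, so that the algorithm and the estimators below are well defined. The requirements on conditional laws are imposed only on the event where these are well defined. \textbf{Estimators.} Let $$\Lambda_t(j,i)=\frac{\omega_t^i\,q(\xi_t^i,\xi_{t+1}^j)}{\sum_{\ell=1}^N\omega_t^\ell\,q(\xi_t^\ell,\xi_{t+1}^j)}.$$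 The FFBSm estimator is $$\hat\phi_{s|T}(h)=\sum_{i_s,\dots,i_T=1}^N\ \prod_{u=s+1}^T\Lambda_{u-1}(i_u,i_{u-1})\ \frac{\omega_T^{i_T}}{\Omega_T}\ h(\xi_s^{i_s}).$$ The FFBSi estimator is $\tilde\phi_{s|T}(h)=N^{-1}\sum_{\ell=1}^N h(\xi_s^{J_s^\ell})$, where, given $\mathcal F_T$, the index paths $J_{0:T}^\ell$, $1\le\ell\le N$, are i.i.d. with $$\mathbb P[J_{0:T}^\ell=i_{0:T}\mid\mathcal F_T]=\frac{\omega_T^{i_T}}{\Omega_T}\prod_{u=1}^T\Lambda_{u-1}(i_u,i_{u-1}).$$ \textbf{Theorem.} Assume: (A1) $\sup_{t\ge0}\sup_x g_t(x)<\infty$; (A2) $\sup_{t\ge1}\sup_x\vartheta_t(x)<\infty$, and the weight functions $\omega_t$, $t\ge0$, are bounded by a common constant ($\omega_0$ up to a $\rho_0$-null set); (A4) there are $0<\sigma_-\le\sigma_+<\infty$ and $c_->0$ such that $\sigma_-\le q(x,x')\le\sigma_+$ for all $x,x'$, $\int g_0\,d\chi\ge c_-$, and $\int q(x,x')\,g_t(x')\,\nu(dx')\ge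 c_-$ for all $t\ge1$ and all $x$. Then there exist constants $0<B,C<\infty$ such that, for all integers $N\ge1$ and $0\le s\le T$, every run of the algorithms with $N$ particles, every bounded measurable $h:\mathsf X\to\mathbb R$ and every $\epsilon>0$, $$\mathbb P\big[\mathcal A_T\cap\{|\hat\phi_{s|T}(h)-\phi_{s|T}(h)|\ge\epsilon\}\big]\le B\,e^{-CN\epsilon^2/\mathrm{osc}(h)^2},$$ $$\mathbb P\big[\mathcal A_T\cap\{|\tilde\phi_{s|T}(h)-\phi_{s|T}(h)|\ge\epsilon\}\big]\le B\,e^{-CN\epsilon^2/\mathrm{osc}(h)^2},$$ where $\mathrm{osc}(h)=\sup_{x,x'}|h(x)-h(x')|$ and the right-hand sides are read as $0$ if $\mathrm{osc}(h)=0$. In particular $B$ and $C$ do not depend on $s$, $T$, $N$, $h$ or $\epsilon$. If almost surely no total weight vanishes (for instance if all $g_t>0$ and $d\chi/d\rho_0>0$ holds $\rho_0$-almost everywhere), then $\mathbb P(\mathcal A_T)=1$ and $\mathcal A_T$ may be dropped from both inequalities. -/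

import Mathlib

open MeasureTheory ProbabilityTheory

noncomputable section

/-- A fully dominated state space model on `X` with the observations fixed: initial law `χ`,
transition density `q` with respect to the `σ`-finite measure `ν`, and likelihoods
`g t x` of the observation made at time `t`. -/
structure StateSpaceModel (X : Type*) [MeasurableSpace X] where
  ν : Measure X
  sigmaFinite_ν : SigmaFinite ν
  χ : Measure X
  isProbabilityMeasure_χ : IsProbabilityMeasure χ
  q : X → X → ℝ
  q_nonneg : ∀ x y, 0 ≤ q x y
  measurable_q : Measurable (Function.uncurry q)
  lintegral_q : ∀ x, ∫⁻ y, ENNReal.ofReal (q x y) ∂ν = 1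
  g : ℕ → X → ℝ
  g_nonneg : ∀ t x, 0 ≤ g t x
  measurable_g : ∀ t, Measurable (g t)

namespace StateSpaceModel

variable {X : Type*} [MeasurableSpace X] (M : StateSpaceModel X)

/-- The density of `(X_0, …, X_T)` and of the observations up to time `T`, with respect to
`χ ⊗ ν ⊗ ⋯ ⊗ ν`. -/
def pathDensity (T : ℕ) (x : Fin (T + 1) → X) : ℝ :=
  (∏ u : Fin T, M.q (x u.castSucc) (x u.succ)) * ∏ u : Fin (T + 1), M.g u (x u)

/-- The unnormalised posterior
`χ(dx_0) g_0(x_0) ∏_{u=1}^T q(x_{u-1}, x_u) g_u(x_u) ν(dx_u)` on paths. -/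
def unnormalizedSmoothing (T : ℕ) : Measure (Fin (T + 1) → X) :=
  (Measure.pi (Fin.cons M.χ (fun _ => M.ν) : Fin (T + 1) → Measure X)).withDensity
    (fun x => ENNReal.ofReal (M.pathDensity T x))

/-- The joint smoothing distribution: the law of `X_{0:T}` given the observations up to `T`. -/
def jointSmoothing (T : ℕ) : Measure (Fin (T + 1) → X) :=
  (M.unnormalizedSmoothing T Set.univ)⁻¹ • M.unnormalizedSmoothing T

/-- The marginal smoothing distribution `φ_{s|T}`: the law of `X_s` given the observations
up to `T`. -/
def smoothing (T : ℕ) (s : Fin (T + 1)) : Measure X :=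
  (M.jointSmoothing T).map (fun x => x s)

/-- The likelihoods are bounded, uniformly in time. -/
def BoundedLikelihood : Prop := ∃ G : ℝ, ∀ t x, M.g t x ≤ G

/-- The strong mixing condition. -/
def StrongMixing : Prop :=
  (∃ σm σp : ℝ, 0 < σm ∧ σm ≤ σp ∧ ∀ x y, σm ≤ M.q x y ∧ M.q x y ≤ σp) ∧
  ∃ c : ℝ, 0 < c ∧ c ≤ ∫ x, M.g 0 x ∂M.χ ∧
    ∀ t, 1 ≤ t → ∀ x, c ≤ ∫ y, M.q x y * M.g t y ∂M.ν

end StateSpaceModel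

/-- The design of an auxiliary particle filter for the model `M`: instrumental initial law `ρ`,
adjustment multipliers `ϑ t` and proposal densities `p t` (with respect to `ν`) for the times
`t ≥ 1` (the entries for `t = 0` play no role). The fields `absolutelyContinuous` and
`dominates` are the absolute continuity that makes the importance weights meaningful. -/
structure AuxiliaryDesign {X : Type*} [MeasurableSpace X] (M : StateSpaceModel X) where
  ρ : Measure X
  isProbabilityMeasure_ρ : IsProbabilityMeasure ρ
  absolutelyContinuous : M.χ ≪ ρ
  ϑ : ℕ → X → ℝ
  ϑ_pos : ∀ t, 1 ≤ t → ∀ x, 0 < ϑ t x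
  measurable_ϑ : ∀ t, 1 ≤ t → Measurable (ϑ t)
  p : ℕ → X → X → ℝ
  p_nonneg : ∀ t, 1 ≤ t → ∀ x y, 0 ≤ p t x y
  measurable_p : ∀ t, 1 ≤ t → Measurable (Function.uncurry (p t))
  lintegral_p : ∀ t, 1 ≤ t → ∀ x, ∫⁻ y, ENNReal.ofReal (p t x y) ∂M.ν = 1
  dominates : ∀ t, 1 ≤ t → ∀ x, ∀ᵐ y ∂M.ν, p t x y = 0 → M.q x y * M.g t y = 0

namespace AuxiliaryDesign

variable {X : Type*} [MeasurableSpace X] {M : StateSpaceModel X} (D : AuxiliaryDesign M)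

/-- The importance weight function at time `0`. -/
def weightFunZero (x : X) : ℝ := (M.χ.rnDeriv D.ρ x).toReal * M.g 0 x

/-- The importance weight function at time `t ≥ 1`. -/
def weightFun (t : ℕ) (x y : X) : ℝ := M.q x y * M.g t y / (D.ϑ t x * D.p t x y)

/-- Adjustment multipliers and importance weight functions are bounded, uniformly in time. -/
def BoundedWeights : Prop :=
  (∃ K : ℝ, ∀ t, 1 ≤ t → ∀ x, D.ϑ t x ≤ K) ∧
  ∃ W : ℝ, (∀ᵐ x ∂D.ρ, D.weightFunZero x ≤ W) ∧
    ∀ t, 1 ≤ t → ∀ x y, D.weightFun t x y ≤ W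

end AuxiliaryDesign

/-- Random particles `ξ t i` and ancestor indices `I t i` (used for `t ≥ 1`), for
`i` in a set of `N` labels. -/
structure ParticleSystem (X : Type*) [MeasurableSpace X] (N : ℕ)
    (Ω : Type*) [MeasurableSpace Ω] where
  ξ : ℕ → Fin N → Ω → X
  I : ℕ → Fin N → Ω → Fin N
  measurable_ξ : ∀ t i, Measurable (ξ t i)
  measurable_I : ∀ t i, Measurable (I t i)

namespace ParticleSystem

variable {X : Type*} [MeasurableSpace X] {N : ℕ} {Ω : Type*} [MeasurableSpace Ω]
  (S : ParticleSystem X N Ω) {M : StateSpaceModel X} (D : AuxiliaryDesign M)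

/-- The importance weight of particle `i` at time `t`. -/
def weight : ℕ → Fin N → Ω → ℝ
  | 0, i, ω => D.weightFunZero (S.ξ 0 i ω)
  | t + 1, i, ω => D.weightFun (t + 1) (S.ξ t (S.I (t + 1) i ω) ω) (S.ξ (t + 1) i ω)

/-- The sum of the weights at time `t`. -/
def totalWeight (t : ℕ) (ω : Ω) : ℝ := ∑ i, S.weight D t i ω

/-- The sums of the weights up to time `t` are positive, so that the algorithm and its
estimators are well defined up to time `t`. -/
def Alive (t : ℕ) (ω : Ω) : Prop := ∀ u ≤ t, 0 < S.totalWeight D u ω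

/-- The `σ`-field generated by the particles and the weights up to time `t`. -/
@[reducible]
def history (t : ℕ) : MeasurableSpace Ω :=
  ⨆ u : {u : ℕ // u ≤ t}, ⨆ i : Fin N,
    MeasurableSpace.comap (fun ω => (S.ξ u i ω, S.weight D u i ω)) inferInstance

/-- The instrumental law on (ancestor, new particle) used to pass from time `t` to `t + 1`: the
probability on `Fin N × X` proportional to
`ω_t^i ϑ_{t+1}(ξ_t^i) p_{t+1}(ξ_t^i, y) ν(dy)`. -/
def instrumental (t : ℕ) (ω : Ω) : Measure (Fin N × X) :=
  (∑ i, ENNReal.ofReal (S.weight D t i ω * D.ϑ (t + 1) (S.ξ t i ω)))⁻¹ •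
    ∑ i, ENNReal.ofReal (S.weight D t i ω * D.ϑ (t + 1) (S.ξ t i ω)) •
      (Measure.dirac i).prod
        (M.ν.withDensity fun y => ENNReal.ofReal (D.p (t + 1) (S.ξ t i ω) y))

/-- `S` is a run of the auxiliary particle filter: the initial particles are i.i.d. with law `ρ`,
and, given the particles and weights up to time `t`, the pairs `(I_{t+1}^i, ξ_{t+1}^i)`,
`i = 1, …, N`, are i.i.d. with the instrumental law, as long as this is well defined. -/
structure IsAuxiliaryFilter (P : Measure Ω) : Prop where
  initial : ∀ A : Fin N → Set X, (∀ i, MeasurableSet (A i)) →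
    P {ω | ∀ i, S.ξ 0 i ω ∈ A i} = ∏ i, D.ρ (A i)
  step : ∀ t, ∀ A : Fin N → Set (Fin N × X), (∀ i, MeasurableSet (A i)) →
    ∀ᵐ ω ∂P, S.Alive D t ω →
      (P⟦{ω' | ∀ i, (S.I (t + 1) i ω', S.ξ (t + 1) i ω') ∈ A i} | S.history D t⟧) ω
        = ∏ i, (S.instrumental D t ω).real (A i)

/-- The backward probability of choosing particle `i` at time `t`, from particle `j` at
time `t + 1`. -/
def backward (t : ℕ) (j i : Fin N) (ω : Ω) : ℝ :=
  S.weight D t i ω * M.q (S.ξ t i ω) (S.ξ (t + 1) j ω) /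
    ∑ l, S.weight D t l ω * M.q (S.ξ t l ω) (S.ξ (t + 1) j ω)

/-- The forward filtering backward smoothing weight of the index path `(i_s, …, i_T)`, `s ≤ T`;
the entry `k` of the tuple is the index at time `s + k`. -/
def pathWeight (s T : ℕ) (i : Fin (T - s + 1) → Fin N) (ω : Ω) : ℝ :=
  (∏ k : Fin (T - s), S.backward D (s + k) (i k.succ) (i k.castSucc) ω) *
    (S.weight D T (i (Fin.last (T - s))) ω / S.totalWeight D T ω)

/-- The FFBSm estimator of `φ_{s|T}(h)`. -/
def ffbsm (s T : ℕ) (h : X → ℝ) (ω : Ω) : ℝ :=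
  ∑ i : Fin (T - s + 1) → Fin N, S.pathWeight D s T i ω * h (S.ξ s (i 0) ω)

/-- `J` is a run of the FFBSi sampler with horizon `T`: given the particles and weights up to time
`T`, the `N` index paths `(J_0^l, …, J_T^l)` are i.i.d., each drawn backwards in time, `J_T`
with the filtering weights and then `J_t` with probability `backward t J_{t+1} ·`. -/
structure IsFFBSi (P : Measure Ω) (T : ℕ) (J : Fin N → Fin (T + 1) → Ω → Fin N) : Prop where
  measurable_J : ∀ l t, Measurable (J l t)
  law : ∀ j : Fin N → Fin (T + 1) → Fin N,
    ∀ᵐ ω ∂P, S.Alive D T ω →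
      (P⟦{ω' | ∀ l t, J l t ω' = j l t} | S.history D T⟧) ω
        = ∏ l, S.pathWeight D 0 T (j l) ω

/-- The FFBSi estimator of `φ_{s|T}(h)`. -/
def ffbsi (T : ℕ) (J : Fin N → Fin (T + 1) → Ω → Fin N) (s : Fin (T + 1)) (h : X → ℝ)
    (ω : Ω) : ℝ :=
  (∑ l, h (S.ξ s (J l s ω) ω)) / N

end ParticleSystem

/-- The oscillation of a bounded function. -/
def osc {X : Type*} (h : X → ℝ) : ℝ := ⨆ z : X × X, |h z.1 - h z.2|

/-- `B exp(- C N ε² / o²)`, read as `0` when `o = 0`. -/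
def deviationBound (B C : ℝ) (N : ℕ) (ε o : ℝ) : ℝ :=
  if o = 0 then 0 else B * Real.exp (-(C * N * ε ^ 2 / o ^ 2))

end

open MeasureTheory ProbabilityTheory

noncomputable section

/-! Interpolate between the smoothing mean of `h` and the FFBSm estimator, one generation of
particles at a time. For each time t let k_t(x) be the mean of h(X_s) given X_t = x (`smoothMean`):
the exact conditional mean if t ≤ s, the mean under the particle backward kernels if t > s. Let
R_{t+1} be the average of k_t over generation t, each particle carrying its importance weight times
the likelihood of the observations after t (`average`), and let R_0 be the exact smoothing mean. At
t = T the future likelihood is 1, so R_{T+1} is the FFBSm estimator (`ffbsm_eq_average`).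

Each increment is the error of a self-normalised importance sampling step. The function k_{t+1}
depends only on the particles up to time t; given these, generation t + 1 is an i.i.d. sample, and
the average over generation t is exactly the ratio of conditional means that generation t + 1
estimates (`sum_integral_smoothMean`). Hoeffding's inequality, applied to both tails of the centred
numerator and to the lower tail of the sum of weights, bounds the deviation of the ratio
(`measureReal_importance_sampling_le`). Its constants do not depend on t, because strong mixing
keeps the future likelihood within a factor σm / σp of a constant (`futureLikelihood_bounds`).

Uniformity in T comes from forgetting. By Doeblin's contraction (`exists_average_mem_Icc`) the
oscillation of k_t is at most (1 - σm / σp)^|t - s| times that of `h`, both for the exact forward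
recursion and for the particle backward kernels. When ε is shared among the increments with
geometrically decreasing shares that decay more slowly than these oscillations, the union bound sums
to a constant multiple of a single Gaussian tail (`measureReal_telescope_le`).

For FFBSi, the index paths are i.i.d. given the particles and their conditional mean is the FFBSm
estimator (`sum_pathWeight_mul`), so one more application of the sampling inequality and a split of
ε into halves suffice. -/

/-! ### Hoeffding's inequality and disintegration of conditional laws -/

/-- Hoeffding's inequality for a function of the coordinates of a product measure. -/
lemma measureReal_pi_sum_ge_le {E : Type*} [MeasurableSpace E] {N : ℕ} (μ : Measure E)
    [IsProbabilityMeasure μ] {f : E → ℝ} (hf : Measurable f) {a b : ℝ}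
    (hfab : ∀ᵐ z ∂μ, f z ∈ Set.Icc a b) (hf0 : ∫ z, f z ∂μ = 0) {δ : ℝ} (hδ : 0 ≤ δ) :
    (Measure.pi fun _ : Fin N => μ).real {z | N * δ ≤ ∑ i, f (z i)}
      ≤ Real.exp (-(2 * N * δ ^ 2 / (b - a) ^ 2)) := by
  have hind : iIndepFun (fun (i : Fin N) (z : Fin N → E) => f (z i))
      (Measure.pi fun _ : Fin N => μ) :=
    iIndepFun_pi (X := fun _ => f) fun _ => hf.aemeasurable
  have hsub : HasSubgaussianMGF f ((‖b - a‖₊ / 2) ^ 2) μ :=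
    hasSubgaussianMGF_of_mem_Icc_of_integral_eq_zero hf.aemeasurable hfab hf0
  have hsub' (i : Fin N) : HasSubgaussianMGF (fun z : Fin N → E => f (z i))
      ((‖b - a‖₊ / 2) ^ 2) (Measure.pi fun _ : Fin N => μ) := by
    have hmp := measurePreserving_eval (fun _ : Fin N => μ) i
    exact HasSubgaussianMGF.of_map (Y := fun z : Fin N → E => z i) hmp.measurable.aemeasurable
      (by rw [show (fun z : Fin N → E => z i) = Function.eval i from rfl, hmp.map_eq]; exact hsub)
  have h := HasSubgaussianMGF.measure_sum_ge_le_of_iIndepFun hind (s := Finset.univ)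
    (fun i _ => hsub' i) (ε := N * δ) (by positivity)
  refine h.trans (le_of_eq ?_)
  congr 1
  simp only [Finset.sum_const, Finset.card_univ, Fintype.card_fin, nsmul_eq_mul]
  push_cast
  rw [Real.norm_eq_abs, div_pow, sq_abs]
  -- In the degenerate cases N = 0 and a = b both exponents are 0, division by zero being 0.
  rcases eq_or_ne (N : ℝ) 0 with hN | hN
  · simp [hN]
  rcases eq_or_ne (b - a) 0 with hab | hab
  · simp [hab]
  field_simp

/-- If, given `Y`, the conditional law of `Z` is `κ (Y ω)` on the event `Y ∈ A`, then probabilities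
of events on `(Y, Z)` are bounded by bounds on the sections. -/
lemma measure_le_of_forall_section_le {Ω Ω' E : Type*} [MeasurableSpace Ω] [MeasurableSpace Ω']
    [mE : MeasurableSpace E] {P : Measure Ω} [IsProbabilityMeasure P] {Y : Ω → Ω'}
    (hY : Measurable Y) {Z : Ω → E} (hZ : Measurable Z) {𝒞 : Set (Set E)}
    (hgen : mE = MeasurableSpace.generateFrom 𝒞) (hpi : IsPiSystem 𝒞)
    (hspan : IsCountablySpanning 𝒞) {κ : Ω' → Measure E} {A : Set Ω'} (hA : MeasurableSet A)
    (hκ : ∀ y ∈ A, IsProbabilityMeasure (κ y))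
    (hm : ∀ B ∈ 𝒞, Measurable (A.indicator fun y => κ y B))
    (hcond : ∀ H, MeasurableSet H → H ⊆ A → ∀ B ∈ 𝒞,
      P (Y ⁻¹' H ∩ Z ⁻¹' B) = ∫⁻ ω in Y ⁻¹' H, κ (Y ω) B ∂P)
    {V : Set (Ω' × E)} (hV : MeasurableSet V) {b : ENNReal}
    (hb : ∀ y ∈ A, κ y {z | (y, z) ∈ V} ≤ b) :
    P {ω | Y ω ∈ A ∧ (Y ω, Z ω) ∈ V} ≤ b := by
  classical
  -- The conditional law is only prescribed on A. Extended by 0 it is a finite kernel, with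
  -- measurability checked on the π-system.
  let κ' : Ω' → Measure E := fun y => if y ∈ A then κ y else 0
  have hκ'B (B : Set E) (y : Ω') : κ' y B = A.indicator (fun y => κ y B) y := by
    by_cases hy : y ∈ A <;> simp [κ', hy]
  have hκ'univ (y : Ω') : κ' y Set.univ = A.indicator 1 y := by
    rw [hκ'B]
    by_cases hy : y ∈ A
    · have := hκ y hy
      simp [hy]
    · simp [hy]
  have hfin (y : Ω') : IsFiniteMeasure (κ' y) := by
    refine ⟨?_⟩
    rw [hκ'univ]
    by_cases hy : y ∈ A <;> simp [hy]
  have hmeas : Measurable κ' := by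
    refine Measurable.measure_of_isPiSystem hgen hpi (fun B hB => ?_) ?_
    · simp_rw [hκ'B]; exact hm B hB
    · simp_rw [hκ'univ]; exact measurable_one.indicator hA
  let K : Kernel Ω' E := ⟨κ', hmeas⟩
  have hKfin : IsFiniteKernel K := by
    refine ⟨⟨1, ENNReal.one_lt_top, fun y => ?_⟩⟩
    change κ' y Set.univ ≤ 1
    rw [hκ'univ]
    by_cases hy : y ∈ A <;> simp [hy]
  -- The joint law of (Y, Z) on Y ∈ A and the composition product of the law of Y with the kernel
  -- agree on rectangles, hence everywhere. The bound on sections is then integrated over the law of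
  -- Y.
  let μ1 : Measure (Ω' × E) := (P.restrict (Y ⁻¹' A)).map fun ω => (Y ω, Z ω)
  let μ2 : Measure (Ω' × E) := (P.map Y) ⊗ₘ K
  have : IsFiniteMeasure (P.map Y) := by infer_instance
  have hμ1 (S : Set (Ω' × E)) (hS : MeasurableSet S) :
      μ1 S = P {ω | Y ω ∈ A ∧ (Y ω, Z ω) ∈ S} := by
    rw [Measure.map_apply (hY.prodMk hZ) hS, Measure.restrict_apply ((hY.prodMk hZ) hS),
      Set.inter_comm]
    rfl
  have hμ2 (S : Set (Ω' × E)) (hS : MeasurableSet S) :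
      μ2 S = ∫⁻ ω, κ' (Y ω) (Prod.mk (Y ω) ⁻¹' S) ∂P := by
    rw [Measure.compProd_apply hS, lintegral_map (Kernel.measurable_kernel_prodMk_left hS) hY]
    rfl
  have hBm (B : Set E) (hB : B ∈ 𝒞) : MeasurableSet B := by
    rw [hgen]; exact MeasurableSpace.measurableSet_generateFrom hB
  have heq : μ1 = μ2 := by
    refine ext_of_generate_finite
      (Set.image2 (· ×ˢ ·) {s : Set Ω' | MeasurableSet s} 𝒞) ?_ ?_ ?_ ?_
    · exact (generateFrom_eq_prod MeasurableSpace.generateFrom_measurableSet hgen.symm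
        isCountablySpanning_measurableSet hspan).symm
    · exact MeasurableSpace.isPiSystem_measurableSet.prod hpi
    · rintro _ ⟨H, hH, B, hB, rfl⟩
      have hH' : MeasurableSet H := hH
      rw [hμ1 _ (hH'.prod (hBm B hB)), hμ2 _ (hH'.prod (hBm B hB))]
      have h1 := hcond (H ∩ A) (hH'.inter hA) Set.inter_subset_right B hB
      have h2 : {ω | Y ω ∈ A ∧ (Y ω, Z ω) ∈ H ×ˢ B} = Y ⁻¹' (H ∩ A) ∩ Z ⁻¹' B := by
        ext ω; simp; tauto
      rw [h2, h1, ← lintegral_indicator (hY (hH'.inter hA))]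
      refine lintegral_congr fun ω => ?_
      rw [hκ'B]
      by_cases hω : Y ω ∈ A <;> by_cases hω' : Y ω ∈ H <;> simp [hω, hω', Set.indicator]
    · rw [hμ1 _ MeasurableSet.univ, hμ2 _ MeasurableSet.univ]
      simp only [Set.preimage_univ, hκ'univ, Set.mem_univ, and_true]
      have : (fun ω => A.indicator (1 : Ω' → ENNReal) (Y ω)) = (Y ⁻¹' A).indicator 1 := by
        ext ω; simp [Set.indicator]
      rw [this, lintegral_indicator_one (hY hA)]
      rfl
  rw [← hμ1 V hV, heq, hμ2 V hV]
  calc ∫⁻ ω, κ' (Y ω) (Prod.mk (Y ω) ⁻¹' V) ∂P ≤ ∫⁻ _, b ∂P := by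
        refine lintegral_mono fun ω => ?_
        rw [hκ'B]
        by_cases hω : Y ω ∈ A
        · rw [Set.indicator_of_mem hω]
          exact hb _ hω
        · simp [hω]
    _ = b := by simp

/-- A version of `measure_le_of_forall_section_le` for conditional probabilities given a
sub-`σ`-field. -/
lemma measure_le_of_condExp {Ω E : Type*} {m : MeasurableSpace Ω} [mΩ : MeasurableSpace Ω] [mE : MeasurableSpace E]
    {P : Measure Ω} [IsProbabilityMeasure P] (hmle : m ≤ mΩ)
    {Z : Ω → E} (hZ : Measurable Z) {𝒞 : Set (Set E)}
    (hgen : mE = MeasurableSpace.generateFrom 𝒞) (hpi : IsPiSystem 𝒞)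
    (hspan : IsCountablySpanning 𝒞) {κ : Ω → Measure E} {A : Set Ω} (hA : MeasurableSet[m] A)
    (hκ : ∀ ω ∈ A, IsProbabilityMeasure (κ ω))
    (hm : ∀ B ∈ 𝒞, Measurable[m] (A.indicator fun ω => κ ω B))
    (hcond : ∀ B ∈ 𝒞, ∀ᵐ ω ∂P, ω ∈ A → (P⟦Z ⁻¹' B | m⟧) ω = (κ ω).real B)
    {V : Set (Ω × E)} (hV : MeasurableSet[m.prod mE] V) {b : ENNReal}
    (hb : ∀ ω ∈ A, κ ω {z | (ω, z) ∈ V} ≤ b) :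
    P {ω | ω ∈ A ∧ (ω, Z ω) ∈ V} ≤ b := by
  -- Conditioning on the σ-field `m` is conditioning on the identity map from Ω to Ω carrying `m`.
  refine @measure_le_of_forall_section_le Ω Ω E mΩ m mE P _ id (measurable_id'' hmle) Z hZ 𝒞 hgen
    hpi hspan κ A hA hκ hm ?_ V hV b hb
  intro H hH hHA B hB
  have hBm : MeasurableSet B := by
    rw [hgen]; exact MeasurableSpace.measurableSet_generateFrom hB
  have hHm : MeasurableSet H := hmle _ hH
  have hZB : MeasurableSet (Z ⁻¹' B) := hZ hBm
  have h1 : ∫ ω in H, (P⟦Z ⁻¹' B | m⟧) ω ∂P = P.real (H ∩ Z ⁻¹' B) := by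
    rw [setIntegral_condExp hmle ((integrable_const _).indicator hZB) hH,
      setIntegral_indicator hZB]
    simp
  have h2 : ∫ ω in H, (P⟦Z ⁻¹' B | m⟧) ω ∂P = ∫ ω in H, (κ ω).real B ∂P := by
    refine setIntegral_congr_ae hHm ?_
    filter_upwards [hcond B hB] with ω hω hωH using hω (hHA hωH)
  have hind : ∀ ω ∈ H, κ ω B = A.indicator (fun ω => κ ω B) ω := fun ω hω => by
    simp [hHA hω]
  have h3 : ∫⁻ ω in H, κ ω B ∂P = ENNReal.ofReal (∫ ω in H, (κ ω).real B ∂P) := by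
    have hae : AEStronglyMeasurable (fun ω => (κ ω).real B) (P.restrict H) := by
      refine AEStronglyMeasurable.congr
        (f := fun ω => (A.indicator (fun ω => κ ω B) ω).toReal) ?_ ?_
      · exact ((hm B hB).mono hmle le_rfl).ennreal_toReal.aestronglyMeasurable
      · filter_upwards [ae_restrict_mem hHm] with ω hω
        rw [← hind ω hω]; rfl
    rw [ofReal_integral_eq_lintegral_ofReal]
    · refine setLIntegral_congr_fun hHm fun ω hω => ?_
      have := hκ ω (hHA hω)
      simp [Measure.real]
    · refine Integrable.mono' (integrable_const 1) hae ?_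
      filter_upwards [ae_restrict_mem hHm] with ω hω
      have := hκ ω (hHA hω)
      rw [Real.norm_of_nonneg measureReal_nonneg]
      exact measureReal_le_one
    · exact Filter.Eventually.of_forall fun ω => measureReal_nonneg
  change P (H ∩ Z ⁻¹' B) = ∫⁻ ω in H, κ ω B ∂P
  rw [h3, ← h2, h1, ofReal_measureReal]

/-! ### Self-normalised importance sampling -/

lemma deviationBound_nonneg {B C ε o : ℝ} {N : ℕ} (hB : 0 ≤ B) : 0 ≤ deviationBound B C N ε o := by
  unfold deviationBound
  split_ifs
  · exact le_rfl
  · positivity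

lemma weighted_average_mem_Icc {ι : Type*} (s : Finset ι) {w k : ι → ℝ} {m c : ℝ}
    (hw : ∀ i ∈ s, 0 ≤ w i) (hs : 0 < ∑ i ∈ s, w i) (hk : ∀ i ∈ s, m ≤ k i ∧ k i ≤ m + c) :
    m ≤ (∑ i ∈ s, w i * k i) / ∑ i ∈ s, w i ∧
      (∑ i ∈ s, w i * k i) / ∑ i ∈ s, w i ≤ m + c := by
  rw [le_div_iff₀ hs, div_le_iff₀ hs, Finset.mul_sum, Finset.mul_sum]
  constructor
  · exact Finset.sum_le_sum fun i hi => by nlinarith [hw i hi, hk i hi]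
  · exact Finset.sum_le_sum fun i hi => by nlinarith [hw i hi, hk i hi]

/-- A deviation inequality for self-normalised importance sampling. -/
lemma measureReal_importance_sampling_le {E : Type*} [MeasurableSpace E] {N : ℕ} (μ : Measure E)
    [IsProbabilityMeasure μ] {w ℓ k : E → ℝ} (hwm : Measurable w) (hℓm : Measurable ℓ)
    (hkm : Measurable k) {W β lam b c m R ε : ℝ} (hw0 : ∀ z, 0 ≤ w z) (hwW : ∀ᵐ z ∂μ, w z ≤ W)
    (hβ : 0 < β) (hwβ : β ≤ ∫ z, w z ∂μ) (hlam : 0 < lam) (hlam1 : lam ≤ 1) (hb : 0 < b)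
    (hℓ : ∀ z, lam * b ≤ ℓ z ∧ ℓ z ≤ b) (hk : ∀ z, m ≤ k z ∧ k z ≤ m + c)
    (hR : ∫ z, w z * ℓ z * k z ∂μ = R * ∫ z, w z * ℓ z ∂μ) (hε : 0 < ε) :
    (Measure.pi fun _ : Fin N => μ).real {z | 0 < ∑ i, w (z i) ∧
        ε ≤ |(∑ i, w (z i) * ℓ (z i) * k (z i)) / (∑ i, w (z i) * ℓ (z i)) - R|}
      ≤ deviationBound 3 (lam ^ 2 * β ^ 2 / (8 * W ^ 2)) N ε c := by
  have hlb : 0 < lam * b := mul_pos hlam hb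
  have hwi : Integrable w μ := Integrable.mono' (integrable_const W) hwm.aestronglyMeasurable
    (by filter_upwards [hwW] with z hz; rwa [Real.norm_of_nonneg (hw0 z)])
  have hv : ∫ z, w z ∂μ ≤ W := by
    calc ∫ z, w z ∂μ ≤ ∫ _, W ∂μ := integral_mono_ae hwi (integrable_const W) hwW
      _ = W := by simp
  have hW : 0 < W := hβ.trans_le (hwβ.trans hv)
  have hwℓi : Integrable (fun z => w z * ℓ z) μ :=
    Integrable.mul_bdd (c := b) hwi hℓm.aestronglyMeasurable
      (Filter.Eventually.of_forall fun z => by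
        rw [Real.norm_of_nonneg (hlb.le.trans (hℓ z).1)]; exact (hℓ z).2)
  have hwℓki : Integrable (fun z => w z * ℓ z * k z) μ :=
    Integrable.mul_bdd (c := |m| + |m + c|) hwℓi hkm.aestronglyMeasurable
      (Filter.Eventually.of_forall fun z => by
        rw [Real.norm_eq_abs]
        refine abs_le.2 ⟨?_, ?_⟩
        · linarith [neg_abs_le m, abs_nonneg (m + c), (hk z).1]
        · linarith [le_abs_self (m + c), abs_nonneg m, (hk z).2])
  have hwℓ0 (z : E) : 0 ≤ w z * ℓ z := mul_nonneg (hw0 z) (hlb.le.trans (hℓ z).1)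
  have hIpos : 0 < ∫ z, w z * ℓ z ∂μ := by
    calc 0 < lam * b * β := by positivity
      _ ≤ lam * b * ∫ z, w z ∂μ := by gcongr
      _ = ∫ z, lam * b * w z ∂μ := (integral_const_mul _ _).symm
      _ ≤ ∫ z, w z * ℓ z ∂μ := integral_mono (hwi.const_mul _) hwℓi fun z => by
          have := mul_le_mul_of_nonneg_left (hℓ z).1 (hw0 z)
          simp only; linarith
  have hRm : m ≤ R := by
    refine le_of_mul_le_mul_right ?_ hIpos
    rw [← hR, ← integral_const_mul]
    refine integral_mono (hwℓi.const_mul _) hwℓki fun z => ?_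
    have := mul_le_mul_of_nonneg_left (hk z).1 (hwℓ0 z)
    simp only; linarith
  have hRc : R ≤ m + c := by
    refine le_of_mul_le_mul_right ?_ hIpos
    rw [← hR, ← integral_const_mul]
    refine integral_mono hwℓki (hwℓi.const_mul _) fun z => ?_
    have := mul_le_mul_of_nonneg_left (hk z).2 (hwℓ0 z)
    simp only; linarith
  have hDpos (z : Fin N → E) : lam * b * ∑ i, w (z i) ≤ ∑ i, w (z i) * ℓ (z i) := by
    rw [Finset.mul_sum]
    refine Finset.sum_le_sum fun i _ => ?_
    have := mul_le_mul_of_nonneg_left (hℓ (z i)).1 (hw0 (z i))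
    linarith
  -- The estimate and its target both lie in [m, m + c], so the event is empty when c < ε. This
  -- covers c = 0, where the bound is 0; below, ε ≤ c is needed for the sum of the weights.
  rcases lt_or_ge c ε with hcε | hcε
  · have hempty : {z : Fin N → E | 0 < ∑ i, w (z i) ∧
        ε ≤ |(∑ i, w (z i) * ℓ (z i) * k (z i)) / (∑ i, w (z i) * ℓ (z i)) - R|} = ∅ := by
      refine Set.eq_empty_of_forall_notMem fun z ⟨hz, hz'⟩ => ?_
      have hD : 0 < ∑ i, w (z i) * ℓ (z i) := (mul_pos hlb hz).trans_le (hDpos z)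
      have h := weighted_average_mem_Icc Finset.univ (fun i _ => hwℓ0 (z i)) hD
        (fun i _ => hk (z i))
      have : |(∑ i, w (z i) * ℓ (z i) * k (z i)) / (∑ i, w (z i) * ℓ (z i)) - R| ≤ c :=
        abs_le.2 ⟨by linarith [h.1], by linarith [h.2]⟩
      linarith
    rw [hempty, measureReal_empty]
    exact deviationBound_nonneg (by norm_num)
  have hc : 0 < c := hε.trans_le hcε
  set f : E → ℝ := fun z => w z * ℓ z * (k z - R) with hf
  have hfm : Measurable f := (hwm.mul hℓm).mul (hkm.sub_const R)
  have hf0 : ∫ z, f z ∂μ = 0 := by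
    have : f = fun z => w z * ℓ z * k z - R * (w z * ℓ z) := by
      ext z; simp only [hf]; ring
    rw [this, integral_sub hwℓki (hwℓi.const_mul _), integral_const_mul, hR, sub_self]
  have hfb : ∀ᵐ z ∂μ, f z ∈ Set.Icc (-(W * b * c)) (W * b * c) := by
    filter_upwards [hwW] with z hz
    rw [Set.mem_Icc, ← abs_le]
    simp only [hf]
    rw [abs_mul, abs_of_nonneg (hwℓ0 z)]
    have h1 : |k z - R| ≤ c := abs_le.2 ⟨by linarith [(hk z).1], by linarith [(hk z).2]⟩
    have h2 : 0 ≤ ℓ z := hlb.le.trans (hℓ z).1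
    exact mul_le_mul (mul_le_mul hz (hℓ z).2 h2 hW.le) h1 (abs_nonneg _) (by positivity)
  -- Unless the weights sum to less than N β / 2, the denominator is at least lam b N β / 2; an
  -- error ε of the ratio then forces |∑ f| ≥ N δ. The factor b cancels against the range of f.
  set δ := lam * b * β * ε / 2 with hδ
  have hδ0 : 0 ≤ δ := by positivity
  set x := lam ^ 2 * β ^ 2 / (8 * W ^ 2) * N * ε ^ 2 / c ^ 2 with hx
  have hS1 : (Measure.pi fun _ : Fin N => μ).real {z | N * δ ≤ ∑ i, f (z i)} ≤ Real.exp (-x) := by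
    refine (measureReal_pi_sum_ge_le μ hfm hfb hf0 hδ0).trans (le_of_eq ?_)
    congr 2
    rw [hx, hδ]
    field_simp
    ring
  have hS2 : (Measure.pi fun _ : Fin N => μ).real {z | N * δ ≤ ∑ i, -f (z i)}
      ≤ Real.exp (-x) := by
    refine (measureReal_pi_sum_ge_le μ hfm.neg (a := -(W * b * c)) (b := W * b * c) ?_ ?_
      hδ0).trans (le_of_eq ?_)
    · filter_upwards [hfb] with z hz
      exact ⟨by simpa using hz.2, by simpa using neg_le_neg hz.1⟩
    · simp [integral_neg, hf0]
    · congr 2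
      rw [hx, hδ]
      field_simp
      ring
  -- Lower tail of the sum of the weights. Its exponent is at least x because lam ε ≤ c.
  have hS3 : (Measure.pi fun _ : Fin N => μ).real
      {z | N * (β / 2) ≤ ∑ i, ((∫ z, w z ∂μ) - w (z i))} ≤ Real.exp (-x) := by
    refine (measureReal_pi_sum_ge_le μ (hwm.const_sub _) (a := (∫ z, w z ∂μ) - W)
      (b := ∫ z, w z ∂μ) ?_ ?_ (by positivity)).trans ?_
    · filter_upwards [hwW] with z hz
      exact ⟨by linarith, by linarith [hw0 z]⟩
    · rw [integral_sub (integrable_const _) hwi]; simp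
    · refine Real.exp_le_exp.2 (neg_le_neg ?_)
      have h1 : lam ^ 2 * ε ^ 2 ≤ 1 * c ^ 2 :=
        mul_le_mul (pow_le_one₀ hlam.le hlam1) (pow_le_pow_left₀ hε.le hcε 2) (by positivity)
          (by norm_num)
      have h2 : x = (N * β ^ 2 / (8 * W ^ 2)) * ((lam ^ 2 * ε ^ 2) / c ^ 2) := by
        rw [hx]; field_simp
      have h3 : (lam ^ 2 * ε ^ 2) / c ^ 2 ≤ 1 := by
        rw [div_le_one (by positivity)]; linarith
      have h4 : 2 * N * (β / 2) ^ 2 / ((∫ z, w z ∂μ) - ((∫ z, w z ∂μ) - W)) ^ 2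
          = (N * β ^ 2 / (8 * W ^ 2)) * 4 := by
        rw [sub_sub_cancel]; field_simp; ring
      rw [h2, h4]
      gcongr
      linarith
  have hsub : {z : Fin N → E | 0 < ∑ i, w (z i) ∧
        ε ≤ |(∑ i, w (z i) * ℓ (z i) * k (z i)) / (∑ i, w (z i) * ℓ (z i)) - R|}
      ⊆ ({z | N * δ ≤ ∑ i, f (z i)} ∪ {z | N * δ ≤ ∑ i, -f (z i)})
        ∪ {z | N * (β / 2) ≤ ∑ i, ((∫ z, w z ∂μ) - w (z i))} := by
    rintro z ⟨hz, hz'⟩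
    by_cases h3 : N * (β / 2) ≤ ∑ i, ((∫ z, w z ∂μ) - w (z i))
    · exact Or.inr h3
    · left
      rw [Finset.sum_sub_distrib] at h3
      simp only [Finset.sum_const, Finset.card_univ, Fintype.card_fin, nsmul_eq_mul] at h3
      have hN : (N : ℝ) * β ≤ N * ∫ z, w z ∂μ := by gcongr
      have hw' : N * (β / 2) ≤ ∑ i, w (z i) := by linarith
      have hD : 0 < ∑ i, w (z i) * ℓ (z i) := (mul_pos hlb hz).trans_le (hDpos z)
      have hD' : lam * b * (N * (β / 2)) ≤ ∑ i, w (z i) * ℓ (z i) :=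
        (mul_le_mul_of_nonneg_left hw' hlb.le).trans (hDpos z)
      have hfs : ∑ i, f (z i) = ((∑ i, w (z i) * ℓ (z i) * k (z i))
          / (∑ i, w (z i) * ℓ (z i)) - R) * ∑ i, w (z i) * ℓ (z i) := by
        rw [sub_mul, div_mul_cancel₀ _ hD.ne', Finset.mul_sum, ← Finset.sum_sub_distrib]
        exact Finset.sum_congr rfl fun i _ => by simp only [hf]; ring
      have habs : N * δ ≤ |∑ i, f (z i)| := by
        rw [hfs, abs_mul, abs_of_pos hD]
        calc N * δ = ε * (lam * b * (N * (β / 2))) := by rw [hδ]; ring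
          _ ≤ _ := mul_le_mul hz' hD' (by positivity) (abs_nonneg _)
      rcases le_abs.1 habs with h | h
      · exact Or.inl h
      · right
        simpa [Finset.sum_neg_distrib] using h
  calc _ ≤ _ := measureReal_mono hsub
    _ ≤ _ := measureReal_union_le _ _
    _ ≤ _ := add_le_add (measureReal_union_le _ _) le_rfl
    _ ≤ Real.exp (-x) + Real.exp (-x) + Real.exp (-x) := by gcongr
    _ = deviationBound 3 (lam ^ 2 * β ^ 2 / (8 * W ^ 2)) N ε c := by
      rw [deviationBound, if_neg hc.ne']; ring

lemma measurableSet_selfNormalized {Ω E : Type*} [MeasurableSpace Ω] [MeasurableSpace E] {N : ℕ}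
    {w k : Ω → E → ℝ} {ℓ : E → ℝ} {R : Ω → ℝ} (hwm : Measurable (Function.uncurry w))
    (hkm : Measurable (Function.uncurry k)) (hℓm : Measurable ℓ) (hRm : Measurable R) (ε : ℝ) :
    MeasurableSet ({y : Ω × (Fin N → E) | 0 < ∑ i, w y.1 (y.2 i)} ∩
      {y | ε ≤ |(∑ i, w y.1 (y.2 i) * ℓ (y.2 i) * k y.1 (y.2 i)) /
        (∑ i, w y.1 (y.2 i) * ℓ (y.2 i)) - R y.1|}) := by
  have hy (i : Fin N) : Measurable fun y : Ω × (Fin N → E) => (y.1, y.2 i) :=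
    measurable_fst.prodMk ((measurable_pi_apply i).comp measurable_snd)
  have hw (i : Fin N) : Measurable fun y : Ω × (Fin N → E) => w y.1 (y.2 i) := hwm.comp (hy i)
  have hk (i : Fin N) : Measurable fun y : Ω × (Fin N → E) => k y.1 (y.2 i) := hkm.comp (hy i)
  refine (measurableSet_lt measurable_const (by fun_prop)).inter
    (measurableSet_le measurable_const ?_)
  fun_prop

/-- Importance sampling from a random law: a deviation inequality for proposals that are i.i.d.
given a sub-`σ`-field. -/
lemma measureReal_cond_importance_sampling_le {Ω E : Type*} {m : MeasurableSpace Ω}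
    [mΩ : MeasurableSpace Ω] [mE : MeasurableSpace E] {P : Measure Ω} [IsProbabilityMeasure P]
    (hmle : m ≤ mΩ) {N : ℕ} {Z : Fin N → Ω → E} (hZ : ∀ i, Measurable (Z i))
    {κ : Ω → Measure E} {A : Set Ω} (hA : MeasurableSet[m] A)
    (hκ : ∀ ω ∈ A, IsProbabilityMeasure (κ ω))
    (hm : ∀ B, MeasurableSet B → Measurable[m] (fun ω => κ ω B))
    (hcond : ∀ B : Fin N → Set E, (∀ i, MeasurableSet (B i)) → ∀ᵐ ω ∂P, ω ∈ A →
      (P⟦{ω' | ∀ i, Z i ω' ∈ B i} | m⟧) ω = ∏ i, (κ ω).real (B i))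
    {w k : Ω → E → ℝ} {ℓ : E → ℝ} {R : Ω → ℝ}
    (hwm : Measurable[m.prod mE] (Function.uncurry w))
    (hkm : Measurable[m.prod mE] (Function.uncurry k)) (hℓm : Measurable ℓ) (hRm : Measurable[m] R)
    {W β lam b c ε : ℝ} (hw0 : ∀ ω z, 0 ≤ w ω z) (hwW : ∀ ω ∈ A, ∀ᵐ z ∂κ ω, w ω z ≤ W)
    (hβ : 0 < β) (hwβ : ∀ ω ∈ A, β ≤ ∫ z, w ω z ∂κ ω) (hlam : 0 < lam) (hlam1 : lam ≤ 1)
    (hb : 0 < b) (hℓ : ∀ z, lam * b ≤ ℓ z ∧ ℓ z ≤ b)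
    (hk : ∀ ω ∈ A, ∃ a, ∀ z, a ≤ k ω z ∧ k ω z ≤ a + c)
    (hR : ∀ ω ∈ A, ∫ z, w ω z * ℓ z * k ω z ∂κ ω = R ω * ∫ z, w ω z * ℓ z ∂κ ω) (hε : 0 < ε) :
    P.real {ω | ω ∈ A ∧ 0 < ∑ i, w ω (Z i ω) ∧
        ε ≤ |(∑ i, w ω (Z i ω) * ℓ (Z i ω) * k ω (Z i ω)) / (∑ i, w ω (Z i ω) * ℓ (Z i ω)) - R ω|}
      ≤ deviationBound 3 (lam ^ 2 * β ^ 2 / (8 * W ^ 2)) N ε c := by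
  have hdb : 0 ≤ deviationBound 3 (lam ^ 2 * β ^ 2 / (8 * W ^ 2)) N ε c :=
    deviationBound_nonneg (by norm_num)
  have hZ' : Measurable fun ω i => Z i ω := measurable_pi_lambda _ hZ
  refine ENNReal.toReal_le_of_le_ofReal hdb ?_
  classical
  let κ' : Ω → Measure (Fin N → E) := fun ω => Measure.pi fun _ => κ ω
  let V : Set (Ω × (Fin N → E)) := {y | 0 < ∑ i, w y.1 (y.2 i)} ∩
    {y | ε ≤ |(∑ i, w y.1 (y.2 i) * ℓ (y.2 i) * k y.1 (y.2 i)) /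
      (∑ i, w y.1 (y.2 i) * ℓ (y.2 i)) - R y.1|}
  refine measure_le_of_condExp (V := V) hmle hZ' generateFrom_pi.symm
    isPiSystem_pi
    (IsCountablySpanning.pi fun _ => isCountablySpanning_measurableSet) (κ := κ') hA ?_ ?_ ?_ ?_ ?_
  · intro ω hω
    have := hκ ω hω
    infer_instance
  · rintro _ ⟨B, hB, rfl⟩
    have hB' : ∀ i, MeasurableSet (B i) := fun i => hB i trivial
    have : (A.indicator fun ω => κ' ω (Set.univ.pi B))
        = A.indicator fun ω => ∏ i, κ ω (B i) := by
      ext ω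
      by_cases hω : ω ∈ A
      · have := hκ ω hω
        simp [hω, κ', Measure.pi_pi]
      · simp [hω]
    rw [this]
    exact (Finset.measurable_prod _ fun i _ => hm _ (hB' i)).indicator hA
  · rintro _ ⟨B, hB, rfl⟩
    filter_upwards [hcond B fun i => hB i trivial] with ω hω hωA
    have := hκ ω hωA
    have hset : (fun ω i => Z i ω) ⁻¹' Set.univ.pi B = {ω' | ∀ i, Z i ω' ∈ B i} := by
      ext; simp
    rw [hset, hω hωA]
    simp [κ', Measure.real, Measure.pi_pi, ENNReal.toReal_prod]
  · exact @measurableSet_selfNormalized _ _ m _ _ _ _ _ _ hwm hkm hℓm hRm ε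
  · intro ω hω
    have := hκ ω hω
    obtain ⟨a, ha⟩ := hk ω hω
    -- With ω frozen, w, k and R are deterministic and the unconditional inequality applies.
    have h := measureReal_importance_sampling_le (N := N) (κ ω)
      (hwm.comp (@measurable_prodMk_left _ _ m _ ω)) hℓm
      (hkm.comp (@measurable_prodMk_left _ _ m _ ω)) (hw0 ω) (hwW ω hω) hβ (hwβ ω hω) hlam hlam1
      hb hℓ ha (hR ω hω) hε
    exact (ENNReal.le_ofReal_iff_toReal_le (measure_ne_top _ _) hdb).2 h

/-! ### Sums over backward index paths -/

/-- Averaging `φ` backwards along `n` transition matrices `B (n - 1), …, B 0`. -/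
def backwardAverage {N : ℕ} (B : ℕ → Fin N → Fin N → ℝ) (φ : Fin N → ℝ) : ℕ → Fin N → ℝ
  | 0 => φ
  | n + 1 => fun j => ∑ i, B n j i * backwardAverage B φ n i

lemma backwardAverage_one {N : ℕ} {B : ℕ → Fin N → Fin N → ℝ} {n : ℕ}
    (hB : ∀ k < n, ∀ j, ∑ i, B k j i = 1) (j : Fin N) :
    backwardAverage B (fun _ => 1) n j = 1 := by
  induction n generalizing j with
  | zero => rfl
  | succ n ih =>
    refine (Finset.sum_congr rfl fun i _ => ?_).trans (hB n (Nat.lt_succ_self n) j)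
    rw [ih (fun k hk => hB k (by omega)), mul_one]

/-- Peels off the last index of the path, which meets only the last transition matrix; it is the
induction step for both path sums below. -/
lemma sum_path_snoc {N n : ℕ} (B : ℕ → Fin N → Fin N → ℝ)
    (F : (Fin (n + 2) → Fin N) → ℝ) :
    ∑ i : Fin (n + 2) → Fin N, (∏ k : Fin (n + 1), B k (i k.succ) (i k.castSucc)) * F i
      = ∑ i : Fin (n + 1) → Fin N, (∏ k : Fin n, B k (i k.succ) (i k.castSucc)) *
          ∑ j, B n j (i (Fin.last n)) * F (Fin.snoc (α := fun _ => Fin N) i j) := by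
  rw [← (Fin.snocEquiv fun _ : Fin (n + 2) => Fin N).sum_comp, Fintype.sum_prod_type,
    Finset.sum_comm]
  refine Finset.sum_congr rfl fun i _ => ?_
  rw [Finset.mul_sum]
  refine Finset.sum_congr rfl fun j _ => ?_
  have h1 (k : Fin (n + 1)) : (Fin.snocEquiv fun _ : Fin (n + 2) => Fin N) (j, i) k.castSucc
      = i k := by simp [Fin.snocEquiv]
  have h2 : (Fin.snocEquiv fun _ : Fin (n + 2) => Fin N) (j, i) (Fin.last (n + 1)) = j := by
    simp [Fin.snocEquiv]
  rw [Fin.prod_univ_castSucc, h1, Fin.succ_last, h2, mul_assoc]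
  congr 1
  refine Finset.prod_congr rfl fun k _ => ?_
  rw [h1, ← Fin.castSucc_succ, h1]
  rfl

/-- The sum over paths of a function of the initial index. -/
lemma sum_path_eq {N : ℕ} (B : ℕ → Fin N → Fin N → ℝ) (φ : Fin N → ℝ) (n : ℕ)
    (r : Fin N → ℝ) :
    ∑ i : Fin (n + 1) → Fin N, (∏ k : Fin n, B k (i k.succ) (i k.castSucc)) *
        r (i (Fin.last n)) * φ (i 0) = ∑ j, r j * backwardAverage B φ n j := by
  induction n generalizing r with
  | zero =>
    rw [← (Equiv.funUnique (Fin 1) (Fin N)).symm.sum_comp]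
    simp [backwardAverage]
  | succ n ih =>
    simp_rw [mul_assoc]
    rw [sum_path_snoc B fun i => r (i (Fin.last (n + 1))) * φ (i 0)]
    -- The last matrix is absorbed into the terminal weights, which is why the induction runs over
    -- all `r`.
    have h := ih fun i => ∑ j, B n j i * r j
    simp_rw [mul_assoc] at h
    have h0 (i : Fin (n + 1) → Fin N) (j : Fin N) :
        (Fin.snoc (α := fun _ => Fin N) i j : Fin (n + 2) → Fin N) 0 = i 0 := by
      rw [← Fin.castSucc_zero, Fin.snoc_castSucc]
    simp only [Fin.snoc_last, h0]
    simp_rw [Finset.sum_mul] at h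
    simp_rw [mul_assoc] at h
    rw [h]
    simp only [backwardAverage]
    rw [Finset.sum_comm]
    refine Finset.sum_congr rfl fun j _ => ?_
    rw [Finset.mul_sum]
    exact Finset.sum_congr rfl fun i _ => by ring

/-- The sum over paths of a function of an intermediate index, for stochastic matrices. -/
lemma sum_path_apply_eq {N : ℕ} {B : ℕ → Fin N → Fin N → ℝ} (φ : Fin N → ℝ) (n : ℕ)
    (hB : ∀ k < n, ∀ j, ∑ i, B k j i = 1) (s : Fin (n + 1)) (r : Fin N → ℝ) :
    ∑ i : Fin (n + 1) → Fin N, (∏ k : Fin n, B k (i k.succ) (i k.castSucc)) *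
        r (i (Fin.last n)) * φ (i s)
      = ∑ j, r j * backwardAverage (fun k => B (s + k)) φ (n - s) j := by
  induction n generalizing r with
  | zero =>
    rw [← (Equiv.funUnique (Fin 1) (Fin N)).symm.sum_comp]
    simp [backwardAverage]
  | succ n ih =>
    simp_rw [mul_assoc]
    rw [sum_path_snoc B fun i => r (i (Fin.last (n + 1))) * φ (i s)]
    -- If the marked index is not the last one, the last matrix is again absorbed into `r`. If it is
    -- the last, everything before it sums to 1 by stochasticity.
    rcases Fin.eq_castSucc_or_eq_last s with ⟨s, rfl⟩ | rfl
    · have h := ih (fun k hk => hB k (by omega)) s fun i => ∑ j, B n j i * r j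
      simp_rw [mul_assoc] at h
      simp only [Fin.snoc_last, Fin.snoc_castSucc]
      simp_rw [Finset.sum_mul] at h
      simp_rw [mul_assoc] at h
      rw [h, Fin.val_castSucc, Nat.succ_sub (by omega)]
      simp only [backwardAverage]
      rw [Finset.sum_comm, show (s : ℕ) + (n - s) = n by omega]
      refine Finset.sum_congr rfl fun j _ => ?_
      rw [Finset.mul_sum]
      exact Finset.sum_congr rfl fun i _ => by ring
    · have h := sum_path_eq B (fun _ => 1) n fun i => ∑ j, B n j i * (r j * φ j)
      simp only [mul_one] at h
      simp only [Fin.snoc_last]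
      rw [h, Fin.val_last, Nat.sub_self]
      change _ = ∑ j, r j * φ j
      have h1 (j : Fin N) : backwardAverage B (fun _ => 1) n j = 1 :=
        backwardAverage_one (fun k hk => hB k (by omega)) j
      simp_rw [h1, mul_one]
      rw [Finset.sum_comm]
      refine Finset.sum_congr rfl fun j _ => ?_
      rw [← Finset.sum_mul, hB n (by omega), one_mul]

/-! ### Combining geometrically small increments -/

/-- With truncated subtraction the exponent is |u - s|. Splitting at s leaves two geometric sums,
each at most 1 / (1 - x). -/
lemma sum_pow_absDiff_le {x : ℝ} (hx0 : 0 ≤ x) (hx1 : x < 1) (s T : ℕ) :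
    ∑ u ∈ Finset.range T, x ^ ((u - s) + (s - u)) ≤ 2 / (1 - x) := by
  have hx : 0 < 1 - x := by linarith
  have hgeom (n : ℕ) : ∑ k ∈ Finset.range n, x ^ k ≤ 1 / (1 - x) := by
    rw [le_div_iff₀ hx, geom_sum_mul_neg]
    linarith [pow_nonneg hx0 n]
  calc ∑ u ∈ Finset.range T, x ^ ((u - s) + (s - u))
      ≤ ∑ u ∈ Finset.range (s + T), x ^ ((u - s) + (s - u)) :=
        Finset.sum_le_sum_of_subset_of_nonneg (Finset.range_mono (by omega))
          fun _ _ _ => pow_nonneg hx0 _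
    _ = ∑ u ∈ Finset.range s, x ^ ((u - s) + (s - u)) + ∑ k ∈ Finset.range T, x ^ k := by
        rw [Finset.sum_range_add]
        congr 1
        exact Finset.sum_congr rfl fun k _ => by congr 1; omega
    _ ≤ ∑ k ∈ Finset.range s, x ^ k + ∑ k ∈ Finset.range T, x ^ k := by
        gcongr ?_ + _
        rw [← Finset.sum_range_reflect (fun k => x ^ k) s]
        refine Finset.sum_le_sum fun u hu => pow_le_pow_of_le_one hx0 hx1.le ?_
        have := Finset.mem_range.1 hu
        omega
    _ ≤ 1 / (1 - x) + 1 / (1 - x) := add_le_add (hgeom s) (hgeom T)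
    _ = 2 / (1 - x) := by ring

/-- Bernoulli's inequality together with r (2 - r) ≤ 1. It is used as r^(-2d) ≥ 1 + d (1 - r), which
turns a geometrically growing exponent into a summable geometric factor. -/
lemma one_add_mul_pow_le_one {r : ℝ} (hr0 : 0 ≤ r) (hr1 : r ≤ 1) (d : ℕ) :
    r ^ (2 * d) * (1 + d * (1 - r)) ≤ 1 := by
  have h1 : 1 + d * (1 - r) ≤ (1 + (1 - r)) ^ d := one_add_mul_le_pow (by linarith) d
  have h2 : r * (1 + (1 - r)) ≤ 1 := by nlinarith [sq_nonneg (1 - r)]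
  calc r ^ (2 * d) * (1 + d * (1 - r)) ≤ r ^ (2 * d) * (1 + (1 - r)) ^ d := by gcongr
    _ = r ^ d * (r * (1 + (1 - r))) ^ d := by rw [mul_pow]; ring
    _ ≤ 1 * 1 := mul_le_mul (pow_le_one₀ hr0 hr1)
        (pow_le_one₀ (mul_nonneg hr0 (by linarith)) h2) (by
          exact pow_nonneg (mul_nonneg hr0 (by linarith)) _) zero_le_one
    _ = 1 := one_mul 1

/-- Deviation inequalities for increments of geometrically decaying size combine into a
deviation inequality that does not depend on the number of increments. -/
lemma measureReal_telescope_le {Ω : Type*} [MeasurableSpace Ω] {P : Measure Ω}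
    [IsProbabilityMeasure P] {A : Set Ω} {R : ℕ → Ω → ℝ} {C r o : ℝ} {N s T : ℕ} (hC : 0 < C)
    (hr0 : 0 < r) (hr1 : r < 1)
    (hstep : ∀ u < T, ∀ ε, 0 < ε → P.real {ω | ω ∈ A ∧ ε ≤ |R (u + 1) ω - R u ω|}
      ≤ deviationBound 3 C N ε (r ^ (2 * ((u - s) + (s - u))) * o)) {ε : ℝ} (hε : 0 < ε) :
    P.real {ω | ω ∈ A ∧ ε ≤ |R T ω - R 0 ω|}
      ≤ deviationBound (6 / (1 - Real.exp (-(1 - r))) + Real.exp 1) (C * ((1 - r) / 2) ^ 2)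
        N ε o := by
  set δ := 1 - r with hδ
  have hδ0 : 0 < δ := by simp only [hδ]; linarith
  -- Normalises the thresholds κ ε r^|u - s| so that they sum to at most ε.
  set κ := δ / 2 with hκ
  have hκ0 : 0 < κ := by positivity
  set d : ℕ → ℕ := fun u => (u - s) + (s - u) with hd
  have hsumε : ∑ u ∈ Finset.range T, κ * ε * r ^ d u ≤ ε := by
    rw [← Finset.mul_sum]
    calc κ * ε * ∑ u ∈ Finset.range T, r ^ d u ≤ κ * ε * (2 / (1 - r)) := by
          gcongr
          exact sum_pow_absDiff_le hr0.le hr1 s T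
      _ = ε := by rw [← hδ, hκ]; field_simp
  have hsub : {ω | ω ∈ A ∧ ε ≤ |R T ω - R 0 ω|} ⊆
      ⋃ u ∈ Finset.range T, {ω | ω ∈ A ∧ κ * ε * r ^ d u ≤ |R (u + 1) ω - R u ω|} := by
    rintro ω ⟨hA, hω⟩
    by_contra hcon
    simp only [Set.mem_iUnion, not_exists, Set.mem_ofPred_eq, not_and, not_le] at hcon
    have hT : 0 < T := by
      rcases Nat.eq_zero_or_pos T with h | h
      · subst h; simp at hω; linarith
      · exact h
    have : |R T ω - R 0 ω| < ε := by
      rw [← Finset.sum_range_sub (fun u => R u ω)]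
      calc |∑ u ∈ Finset.range T, (R (u + 1) ω - R u ω)|
          ≤ ∑ u ∈ Finset.range T, |R (u + 1) ω - R u ω| := Finset.abs_sum_le_sum_abs _ _
        _ < ∑ u ∈ Finset.range T, κ * ε * r ^ d u :=
            Finset.sum_lt_sum_of_nonempty ⟨0, Finset.mem_range.2 hT⟩ fun u hu => hcon u hu hA
        _ ≤ ε := hsumε
    linarith
  have hle : P.real {ω | ω ∈ A ∧ ε ≤ |R T ω - R 0 ω|} ≤
      ∑ u ∈ Finset.range T, deviationBound 3 C N (κ * ε * r ^ d u) (r ^ (2 * d u) * o) :=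
    (measureReal_mono hsub (measure_ne_top _ _)).trans ((measureReal_biUnion_finset_le _ _).trans
      (Finset.sum_le_sum fun u hu => hstep u (Finset.mem_range.1 hu) _ (by positivity)))
  rcases eq_or_ne o 0 with ho | ho
  · simpa [deviationBound, ho] using hle
  set x := C * κ ^ 2 * N * ε ^ 2 / o ^ 2 with hx
  have hx0 : 0 ≤ x := by positivity
  have hexpδ : 0 < 1 - Real.exp (-δ) := by
    have : Real.exp (-δ) < 1 := Real.exp_lt_one_iff.2 (by linarith)
    linarith
  rw [deviationBound, if_neg ho]
  -- For x < 1 the summand exp 1 of the constant makes the bound exceed 1. For x ≥ 1 the extra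
  -- exponent x d δ is at least d δ, so the series converges uniformly in x.
  rcases lt_or_ge x 1 with hx1 | hx1
  · calc P.real {ω | ω ∈ A ∧ ε ≤ |R T ω - R 0 ω|} ≤ 1 := measureReal_le_one
      _ = Real.exp 1 * Real.exp (-1) := by rw [← Real.exp_add]; simp
      _ ≤ (6 / (1 - Real.exp (-δ)) + Real.exp 1) * Real.exp (-x) := by
        gcongr
        exact le_add_of_nonneg_left (by positivity)
  · refine hle.trans ?_
    have hterm (u : ℕ) : deviationBound 3 C N (κ * ε * r ^ d u) (r ^ (2 * d u) * o)
        ≤ 3 * Real.exp (-x) * Real.exp (-δ) ^ d u := by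
      have hp : 0 < r ^ (2 * d u) := by positivity
      rw [deviationBound, if_neg (mul_ne_zero hp.ne' ho), mul_assoc 3, ← Real.exp_nat_mul,
        ← Real.exp_add]
      -- The thresholds decay like r^d and the oscillations like r^(2d), so the exponent grows like
      -- r^(-2d).
      have h1 : C * N * (κ * ε * r ^ d u) ^ 2 / (r ^ (2 * d u) * o) ^ 2 = x * (r ^ (2 * d u))⁻¹ := by
        rw [hx, show (r ^ (2 * d u) * o) ^ 2 = r ^ (2 * d u) * (r ^ d u) ^ 2 * o ^ 2 by ring]
        field_simp
      have h2 : 1 + d u * δ ≤ (r ^ (2 * d u))⁻¹ := by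
        rw [le_inv_comm₀ (by positivity) hp, ← one_div, le_div_iff₀ (by positivity)]
        exact one_add_mul_pow_le_one hr0.le hr1.le _
      have h3 : x + d u * δ ≤ x * (r ^ (2 * d u))⁻¹ := by
        have h4 := mul_le_mul_of_nonneg_left h2 hx0
        have h5 : (d u : ℝ) * δ ≤ x * (d u * δ) :=
          le_mul_of_one_le_left (by positivity) hx1
        linarith
      gcongr
      rw [h1]
      linarith
    calc _ ≤ ∑ u ∈ Finset.range T, 3 * Real.exp (-x) * Real.exp (-δ) ^ d u :=
          Finset.sum_le_sum fun u _ => hterm u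
      _ = 3 * Real.exp (-x) * ∑ u ∈ Finset.range T, Real.exp (-δ) ^ d u := by
          rw [Finset.mul_sum]
      _ ≤ 3 * Real.exp (-x) * (2 / (1 - Real.exp (-δ))) := by
          gcongr
          exact sum_pow_absDiff_le (Real.exp_pos _).le (by linarith) s T
      _ = 6 / (1 - Real.exp (-δ)) * Real.exp (-x) := by ring
      _ ≤ (6 / (1 - Real.exp (-δ)) + Real.exp 1) * Real.exp (-x) := by
          gcongr
          exact le_add_of_nonneg_right (Real.exp_pos _).le

/-! ### Doeblin's contraction -/

/-- This is the minorisation condition: since σm v ≤ u ≤ σp v, the normalised density of u is at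
least σm / σp times that of v. -/
lemma ratio_mul_average_le_average {Y : Type*} [MeasurableSpace Y] {μ : Measure Y} {u v f : Y → ℝ}
    {σm σp K : ℝ} (hσm : 0 < σm) (hσ : σm ≤ σp) (hvi : Integrable v μ) (hvpos : 0 < ∫ y, v y ∂μ)
    (hum : AEStronglyMeasurable u μ) (hv0 : ∀ y, 0 ≤ v y)
    (hu : ∀ y, σm * v y ≤ u y ∧ u y ≤ σp * v y) (hfm : AEStronglyMeasurable f μ)
    (hf : ∀ y, 0 ≤ f y ∧ f y ≤ K) :
    σm / σp * ((∫ y, v y * f y ∂μ) / ∫ y, v y ∂μ) ≤ (∫ y, u y * f y ∂μ) / ∫ y, u y ∂μ := by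
  have hσp : 0 < σp := hσm.trans_le hσ
  have hfb : ∀ᵐ y ∂μ, ‖f y‖ ≤ K := Filter.Eventually.of_forall fun y => by
    rw [Real.norm_of_nonneg (hf y).1]; exact (hf y).2
  have hui : Integrable u μ := Integrable.mono' (hvi.const_mul σp) hum
    (Filter.Eventually.of_forall fun y => by
      rw [Real.norm_of_nonneg ((mul_nonneg hσm.le (hv0 y)).trans (hu y).1)]; exact (hu y).2)
  have hvf : Integrable (fun y => v y * f y) μ := Integrable.mul_bdd hvi hfm hfb
  have huf : Integrable (fun y => u y * f y) μ := Integrable.mul_bdd hui hfm hfb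
  have h1 : σm * ∫ y, v y ∂μ ≤ ∫ y, u y ∂μ := by
    rw [← integral_const_mul]
    exact integral_mono (hvi.const_mul _) hui fun y => (hu y).1
  have h2 : ∫ y, u y ∂μ ≤ σp * ∫ y, v y ∂μ := by
    rw [← integral_const_mul]
    exact integral_mono hui (hvi.const_mul _) fun y => (hu y).2
  have h3 : σm * ∫ y, v y * f y ∂μ ≤ ∫ y, u y * f y ∂μ := by
    rw [← integral_const_mul]
    refine integral_mono (hvf.const_mul _) huf fun y => ?_
    have := mul_le_mul_of_nonneg_right (hu y).1 (hf y).1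
    simp only; linarith
  have hupos : 0 < ∫ y, u y ∂μ := (mul_pos hσm hvpos).trans_le h1
  have h4 : 0 ≤ ∫ y, v y * f y ∂μ := integral_nonneg fun y => mul_nonneg (hv0 y) (hf y).1
  calc σm / σp * ((∫ y, v y * f y ∂μ) / ∫ y, v y ∂μ)
      = (σm * ∫ y, v y * f y ∂μ) / (σp * ∫ y, v y ∂μ) := by rw [div_mul_div_comm]
    _ ≤ (∫ y, u y * f y ∂μ) / ∫ y, u y ∂μ :=
      div_le_div₀ ((mul_nonneg hσm.le h4).trans h3) h3 hupos h2

/-- Doeblin's contraction: averages of `k` with respect to comparable densities `u x` differ by less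
than the values of `k`. -/
lemma exists_average_mem_Icc {Y ι : Type*} [MeasurableSpace Y] {μ : Measure Y} {u : ι → Y → ℝ}
    {v k : Y → ℝ} {σm σp a c : ℝ} (hσm : 0 < σm) (hσ : σm ≤ σp) (hvi : Integrable v μ)
    (hvpos : 0 < ∫ y, v y ∂μ) (hum : ∀ x, AEStronglyMeasurable (u x) μ) (hv0 : ∀ y, 0 ≤ v y)
    (hu : ∀ x y, σm * v y ≤ u x y ∧ u x y ≤ σp * v y) (hkm : AEStronglyMeasurable k μ)
    (hk : ∀ y, a ≤ k y ∧ k y ≤ a + c) :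
    ∃ a', ∀ x, a' ≤ (∫ y, u x y * k y ∂μ) / (∫ y, u x y ∂μ) ∧
      (∫ y, u x y * k y ∂μ) / (∫ y, u x y ∂μ) ≤ a' + (1 - σm / σp) * c := by
  have hkb : ∀ᵐ y ∂μ, ‖k y‖ ≤ |a| + |a + c| := Filter.Eventually.of_forall fun y => by
    refine abs_le.2 ⟨?_, ?_⟩
    · linarith [neg_abs_le a, abs_nonneg (a + c), (hk y).1]
    · linarith [le_abs_self (a + c), abs_nonneg a, (hk y).2]
  have key {w : Y → ℝ} (hwi : Integrable w μ) (hwpos : 0 < ∫ y, w y ∂μ) :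
      (∫ y, w y * (k y - a) ∂μ) / (∫ y, w y ∂μ) = (∫ y, w y * k y ∂μ) / (∫ y, w y ∂μ) - a ∧
      (∫ y, w y * (a + c - k y) ∂μ) / (∫ y, w y ∂μ)
        = a + c - (∫ y, w y * k y ∂μ) / (∫ y, w y ∂μ) := by
    have hwk : Integrable (fun y => w y * k y) μ := Integrable.mul_bdd hwi hkm hkb
    constructor
    · simp_rw [mul_sub]
      rw [integral_sub hwk (hwi.mul_const _), integral_mul_const, sub_div,
        mul_div_cancel_left₀ _ hwpos.ne']
    · simp_rw [mul_sub]
      rw [integral_sub (hwi.mul_const _) hwk, integral_mul_const, sub_div,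
        mul_div_cancel_left₀ _ hwpos.ne']
  set η := (∫ y, v y * k y ∂μ) / ∫ y, v y ∂μ with hη
  -- Minorisation applied to k - a gives this lower end. Applied to a + c - k it gives the upper end
  -- a + c - (σm / σp) (a + c - η), which exceeds the lower end by (1 - σm / σp) c. Neither depends
  -- on x.
  refine ⟨a + σm / σp * (η - a), fun x => ?_⟩
  have hui : Integrable (u x) μ := Integrable.mono' (hvi.const_mul σp) (hum x)
    (Filter.Eventually.of_forall fun y => by
      rw [Real.norm_of_nonneg ((mul_nonneg hσm.le (hv0 y)).trans (hu x y).1)]; exact (hu x y).2)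
  have hupos : 0 < ∫ y, u x y ∂μ := by
    refine (mul_pos hσm hvpos).trans_le ?_
    rw [← integral_const_mul]
    exact integral_mono (hvi.const_mul _) hui fun y => (hu x y).1
  have h1 := ratio_mul_average_le_average (K := c) hσm hσ hvi hvpos (hum x) hv0 (hu x)
    (f := fun y => k y - a) (hkm.sub aestronglyMeasurable_const)
    fun y => ⟨by linarith [(hk y).1], by linarith [(hk y).2]⟩
  have h2 := ratio_mul_average_le_average (K := c) hσm hσ hvi hvpos (hum x) hv0 (hu x)
    (f := fun y => a + c - k y) (aestronglyMeasurable_const.sub hkm)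
    fun y => ⟨by linarith [(hk y).2], by linarith [(hk y).1]⟩
  rw [(key hvi hvpos).1, (key hui hupos).1] at h1
  rw [(key hvi hvpos).2, (key hui hupos).2] at h2
  constructor
  · linarith
  · rw [← hη] at h2
    have : σm / σp * (a + c - η) = σm / σp * c - σm / σp * (η - a) := by ring
    linarith

/-! ### Forward recursions and integrals over paths -/

namespace StateSpaceModel

variable {X : Type*} [MeasurableSpace X] (M : StateSpaceModel X)

/-- The integral of `∏ q (x_{u-1}, x_u) a_u (x_u)` over the `n` states that follow the state `x` at
time `t`. -/
def forwardIntegral (a : ℕ → X → ℝ) : ℕ → ℕ → X → ℝ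
  | 0, _ => fun _ => 1
  | n + 1, t => fun x => ∫ y, M.q x y * (a (t + 1) y * forwardIntegral a n (t + 1) y) ∂M.ν

/-- The likelihood of the observations at the times `t + 1, …, T`, given the state at time `t`. -/
def futureLikelihood (T t : ℕ) (x : X) : ℝ := M.forwardIntegral M.g (T - t) t x

/-- The conditional mean of `h (X_s)` given the observations up to time `T` and the state at
time `s - d`. -/
def forwardMean (T s : ℕ) (h : X → ℝ) : ℕ → X → ℝ
  | 0 => h
  | d + 1 => fun x =>
      (∫ y, M.q x y * (M.g (s - d) y * M.futureLikelihood T (s - d) y) * forwardMean T s h d y ∂M.ν)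
        / ∫ y, M.q x y * (M.g (s - d) y * M.futureLikelihood T (s - d) y) ∂M.ν

/-- Explicit constants for the boundedness and mixing assumptions. -/
structure UniformBounds (σm σp G c : ℝ) : Prop where
  σm_pos : 0 < σm
  σm_le : σm ≤ σp
  le_q : ∀ x y, σm ≤ M.q x y
  q_le : ∀ x y, M.q x y ≤ σp
  g_le : ∀ t x, M.g t x ≤ G
  c_pos : 0 < c
  le_init : c ≤ ∫ x, M.g 0 x ∂M.χ
  le_step : ∀ t, 1 ≤ t → ∀ x, c ≤ ∫ y, M.q x y * M.g t y ∂M.ν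

variable {M} {a : ℕ → X → ℝ} {G : ℝ}

lemma measurable_q_left (x : X) : Measurable (M.q x) :=
  M.measurable_q.comp measurable_prodMk_left

lemma integrable_q (x : X) : Integrable (M.q x) M.ν := by
  refine ⟨(measurable_q_left x).aestronglyMeasurable, ?_⟩
  rw [hasFiniteIntegral_iff_ofReal (Filter.Eventually.of_forall (M.q_nonneg x)), M.lintegral_q]
  exact ENNReal.one_lt_top

lemma integral_q (x : X) : ∫ y, M.q x y ∂M.ν = 1 := by
  rw [integral_eq_lintegral_of_nonneg_ae (Filter.Eventually.of_forall (M.q_nonneg x))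
    (measurable_q_left x).aestronglyMeasurable, M.lintegral_q, ENNReal.toReal_one]

lemma integrable_q_mul {φ : X → ℝ} (hφ : Measurable φ) {K : ℝ} (hK : ∀ y, |φ y| ≤ K) (x : X) :
    Integrable (fun y => M.q x y * φ y) M.ν :=
  Integrable.mul_bdd (integrable_q x) hφ.aestronglyMeasurable (Filter.Eventually.of_forall hK)

lemma measurable_integral_q_mul {φ : X → ℝ} (hφ : Measurable φ) :
    Measurable fun x => ∫ y, M.q x y * φ y ∂M.ν := by
  have := M.sigmaFinite_ν
  have h : Measurable fun z : X × X => M.q z.1 z.2 * φ z.2 :=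
    M.measurable_q.mul (hφ.comp measurable_snd)
  exact (h.stronglyMeasurable.integral_prod_right' (ν := M.ν)).measurable

lemma abs_integral_q_mul_le {φ : X → ℝ} (hφ : Measurable φ) {K : ℝ} (hK : ∀ y, |φ y| ≤ K)
    (x : X) : |∫ y, M.q x y * φ y ∂M.ν| ≤ K := by
  calc |∫ y, M.q x y * φ y ∂M.ν| ≤ ∫ y, |M.q x y * φ y| ∂M.ν := abs_integral_le_integral_abs
    _ ≤ ∫ y, M.q x y * K ∂M.ν := by
        refine integral_mono (integrable_q_mul hφ hK x).abs ((integrable_q x).mul_const K)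
          fun y => ?_
        simp only [abs_mul, abs_of_nonneg (M.q_nonneg x y)]
        exact mul_le_mul_of_nonneg_left (hK y) (M.q_nonneg x y)
    _ = K := by rw [integral_mul_const, integral_q, one_mul]

lemma measurable_forwardIntegral (ha : ∀ t, Measurable (a t)) (n t : ℕ) :
    Measurable (M.forwardIntegral a n t) := by
  induction n generalizing t with
  | zero => exact measurable_const
  | succ n ih => exact measurable_integral_q_mul ((ha _).mul (ih _))

lemma abs_forwardIntegral_le (ha : ∀ t, Measurable (a t)) (haG : ∀ t x, |a t x| ≤ G) (n t : ℕ)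
    (x : X) : |M.forwardIntegral a n t x| ≤ G ^ n := by
  induction n generalizing t x with
  | zero => simp [forwardIntegral]
  | succ n ih =>
    refine abs_integral_q_mul_le ((ha _).mul (measurable_forwardIntegral ha _ _)) (fun y => ?_) x
    change |a (t + 1) y * M.forwardIntegral a n (t + 1) y| ≤ _
    rw [abs_mul, pow_succ']
    exact mul_le_mul (haG _ _) (ih _ _) (abs_nonneg _) ((abs_nonneg _).trans (haG 0 y))

lemma forwardIntegral_nonneg (ha0 : ∀ t x, 0 ≤ a t x) (n t : ℕ) (x : X) :
    0 ≤ M.forwardIntegral a n t x := by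
  induction n generalizing t x with
  | zero => exact zero_le_one
  | succ n ih =>
    exact integral_nonneg fun y => mul_nonneg (M.q_nonneg _ _) (mul_nonneg (ha0 _ _) (ih _ _))

lemma abs_mul_forwardIntegral_le (ha : ∀ t, Measurable (a t)) (haG : ∀ t x, |a t x| ≤ G)
    (n t : ℕ) (x : X) : |a t x * M.forwardIntegral a n t x| ≤ G ^ (n + 1) := by
  rw [abs_mul, pow_succ']
  exact mul_le_mul (haG _ _) (abs_forwardIntegral_le ha haG _ _ _) (abs_nonneg _)
    ((abs_nonneg _).trans (haG 0 x))

/-- The forward integral is an integral over paths. -/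
lemma lintegral_pathDensity (ha : ∀ t, Measurable (a t)) (ha0 : ∀ t x, 0 ≤ a t x)
    (haG : ∀ t x, |a t x| ≤ G) (n t : ℕ) (μ : Measure X) [SigmaFinite μ] {f : X → ENNReal}
    (hf : Measurable f) :
    ∫⁻ z, f (z 0) * ENNReal.ofReal ((∏ u : Fin n, M.q (z u.castSucc) (z u.succ)) *
        ∏ u : Fin (n + 1), a (t + u) (z u))
        ∂Measure.pi (Fin.cons μ (fun _ => M.ν) : Fin (n + 1) → Measure X)
      = ∫⁻ x, f x * ENNReal.ofReal (a t x * M.forwardIntegral a n t x) ∂μ := by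
  have hν := M.sigmaFinite_ν
  have hσ (n : ℕ) (μ : Measure X) [SigmaFinite μ] (i : Fin (n + 1)) :
      SigmaFinite ((Fin.cons μ (fun _ => M.ν) : Fin (n + 1) → Measure X) i) := by
    refine Fin.cases ?_ (fun i => ?_) i
    · simpa
    · simpa
  have hmeas (n t : ℕ) : Measurable fun z : Fin (n + 1) → X =>
      ENNReal.ofReal ((∏ u : Fin n, M.q (z u.castSucc) (z u.succ)) *
        ∏ u : Fin (n + 1), a (t + u) (z u)) := by
    refine ENNReal.measurable_ofReal.comp ((Finset.measurable_prod _ fun u _ => ?_).mul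
      (Finset.measurable_prod _ fun u _ => (ha _).comp (measurable_pi_apply u)))
    have hz : Measurable fun z : Fin (n + 1) → X => (z u.castSucc, z u.succ) :=
      (measurable_pi_apply u.castSucc).prodMk (measurable_pi_apply u.succ)
    exact M.measurable_q.comp hz
  have hmeas' (n t : ℕ) {f : X → ENNReal} (hf : Measurable f) :
      Measurable fun z : Fin (n + 1) → X => f (z 0) *
        ENNReal.ofReal ((∏ u : Fin n, M.q (z u.castSucc) (z u.succ)) *
          ∏ u : Fin (n + 1), a (t + u) (z u)) :=
    (hf.comp (measurable_pi_apply 0)).mul (hmeas n t)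
  have hsplit (n : ℕ) (μ : Measure X) [SigmaFinite μ] {F : (Fin (n + 1) → X) → ENNReal}
      (hF : Measurable F) :
      ∫⁻ z, F z ∂Measure.pi (Fin.cons μ (fun _ => M.ν) : Fin (n + 1) → Measure X)
        = ∫⁻ x, ∫⁻ z : Fin n → X, F (Fin.cons x z) ∂Measure.pi (fun _ => M.ν) ∂μ := by
    have hmp := measurePreserving_piFinSuccAbove
      (Fin.cons μ (fun _ => M.ν) : Fin (n + 1) → Measure X) 0
    rw [← hmp.symm.lintegral_comp hF]
    simp only [Fin.cons_zero, Fin.zero_succAbove, Fin.cons_succ]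
    refine (lintegral_prod (μ := μ) (ν := Measure.pi fun _ : Fin n => M.ν)
      (fun z => F ((MeasurableEquiv.piFinSuccAbove (fun _ : Fin (n + 1) => X) 0).symm z))
      (hF.comp (MeasurableEquiv.measurable _)).aemeasurable).trans
      (lintegral_congr fun x => lintegral_congr fun z => ?_)
    simp [MeasurableEquiv.piFinSuccAbove, Fin.insertNthEquiv]
  induction n generalizing t μ f with
  | zero =>
    rw [hsplit 0 μ (hmeas' 0 t hf)]
    refine lintegral_congr fun x => ?_
    simp [forwardIntegral]
  | succ n ih =>
    rw [hsplit (n + 1) μ (hmeas' (n + 1) t hf)]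
    refine lintegral_congr fun x => ?_
    -- In the induction hypothesis ν takes the place of μ and the first transition density q(x, ·)
    -- that of f.
    have hcons : (fun _ : Fin (n + 1) => M.ν) = Fin.cons M.ν (fun _ => M.ν) := by
      ext1 i
      refine Fin.cases rfl (fun i => rfl) i
    have hint (z : Fin (n + 1) → X) :
        f ((Fin.cons x z : Fin (n + 2) → X) 0) * ENNReal.ofReal
          ((∏ u : Fin (n + 1), M.q ((Fin.cons x z : Fin (n + 2) → X) u.castSucc)
            ((Fin.cons x z : Fin (n + 2) → X) u.succ)) *
            ∏ u : Fin (n + 2), a (t + u) ((Fin.cons x z : Fin (n + 2) → X) u))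
        = (f x * ENNReal.ofReal (a t x)) * (ENNReal.ofReal (M.q x (z 0)) *
          ENNReal.ofReal ((∏ u : Fin n, M.q (z u.castSucc) (z u.succ)) *
            ∏ u : Fin (n + 1), a (t + 1 + u) (z u))) := by
      rw [Fin.prod_univ_succ, Fin.prod_univ_succ (n := n + 1)]
      simp only [Fin.cons_zero, Fin.cons_succ, Fin.castSucc_zero, Fin.val_zero, Fin.val_succ,
        add_zero, ← Fin.succ_castSucc]
      rw [← ENNReal.ofReal_mul (M.q_nonneg _ _), mul_assoc (f x), ← ENNReal.ofReal_mul (ha0 _ _)]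
      congr 2
      have : ∀ u : Fin (n + 1), t + ((u : ℕ) + 1) = t + 1 + u := fun u => by ring
      simp only [this]
      ring
    simp_rw [hint]
    have hq : Measurable fun y => ENNReal.ofReal (M.q x y) :=
      ENNReal.measurable_ofReal.comp (measurable_q_left x)
    rw [lintegral_const_mul _ (hmeas' n (t + 1) hq), hcons,
      ih (t + 1) M.ν hq, mul_assoc, ENNReal.ofReal_mul (ha0 _ _)]
    congr 2
    simp only [forwardIntegral]
    rw [ofReal_integral_eq_lintegral_ofReal]
    · refine lintegral_congr fun y => ?_
      rw [ENNReal.ofReal_mul (M.q_nonneg _ _)]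
    · exact integrable_q_mul ((ha _).mul (measurable_forwardIntegral ha _ _))
        (abs_mul_forwardIntegral_le ha haG _ _) x
    · exact Filter.Eventually.of_forall fun y => mul_nonneg (M.q_nonneg _ _)
        (mul_nonneg (ha0 _ _) (forwardIntegral_nonneg ha0 _ _ _))

end StateSpaceModel

/-! ### Consequences of strong mixing; the smoothing distribution by forward recursion -/

namespace StateSpaceModel

variable {X : Type*} [MeasurableSpace X] {M : StateSpaceModel X} {σm σp G c : ℝ}

lemma futureLikelihood_self (T : ℕ) (x : X) : M.futureLikelihood T T x = 1 := by
  simp [futureLikelihood, forwardIntegral]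

lemma futureLikelihood_eq {T t : ℕ} (ht : t < T) (x : X) :
    M.futureLikelihood T t x
      = ∫ y, M.q x y * (M.g (t + 1) y * M.futureLikelihood T (t + 1) y) ∂M.ν := by
  obtain ⟨n, rfl⟩ : ∃ n, T = t + 1 + n := ⟨T - (t + 1), by omega⟩
  simp only [futureLikelihood]
  rw [show t + 1 + n - t = n + 1 by omega, show t + 1 + n - (t + 1) = n by omega]
  rfl

lemma measurable_futureLikelihood (T t : ℕ) : Measurable (M.futureLikelihood T t) :=
  measurable_forwardIntegral M.measurable_g _ _

lemma futureLikelihood_nonneg (T t : ℕ) (x : X) : 0 ≤ M.futureLikelihood T t x :=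
  forwardIntegral_nonneg M.g_nonneg _ _ _

lemma measurable_g_mul_futureLikelihood (T t : ℕ) :
    Measurable fun y => M.g t y * M.futureLikelihood T t y :=
  (M.measurable_g t).mul (measurable_futureLikelihood T t)

lemma measurable_forwardMean (T s : ℕ) {h : X → ℝ} (hh : Measurable h) (d : ℕ) :
    Measurable (M.forwardMean T s h d) := by
  induction d with
  | zero => exact hh
  | succ d ih =>
    simp only [forwardMean]
    simp_rw [mul_assoc]
    refine Measurable.div (measurable_integral_q_mul
      (φ := fun y => M.g (s - d) y * (M.futureLikelihood T (s - d) y * M.forwardMean T s h d y)) ?_)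
      (measurable_integral_q_mul (measurable_g_mul_futureLikelihood T (s - d)))
    exact (M.measurable_g _).mul ((measurable_futureLikelihood _ _).mul ih)

namespace UniformBounds

lemma σp_pos (H : M.UniformBounds σm σp G c) : 0 < σp := H.σm_pos.trans_le H.σm_le

lemma ratio_pos (H : M.UniformBounds σm σp G c) : 0 < σm / σp := div_pos H.σm_pos H.σp_pos

lemma ratio_le_one (H : M.UniformBounds σm σp G c) : σm / σp ≤ 1 :=
  (div_le_one H.σp_pos).2 H.σm_le

lemma abs_g_le (H : M.UniformBounds σm σp G c) (t : ℕ) (x : X) : |M.g t x| ≤ G := by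
  rw [abs_of_nonneg (M.g_nonneg t x)]; exact H.g_le t x

lemma nonempty (M : StateSpaceModel X) : Nonempty X := by
  have := M.isProbabilityMeasure_χ
  exact M.χ.nonempty_of_neZero

/-- Integrating σm ≤ q(x, ·) gives σm ν(X) ≤ 1. Bounded measurable functions thus become
ν-integrable. -/
lemma isFiniteMeasure_ν (H : M.UniformBounds σm σp G c) : IsFiniteMeasure M.ν := by
  obtain ⟨x⟩ := nonempty M
  refine ⟨?_⟩
  have h1 : ENNReal.ofReal σm * M.ν Set.univ ≤ 1 := by
    rw [← M.lintegral_q x, ← lintegral_const]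
    exact lintegral_mono fun y => ENNReal.ofReal_le_ofReal (H.le_q x y)
  by_contra hcon
  rw [not_lt, top_le_iff] at hcon
  rw [hcon, ENNReal.mul_top (by simpa using H.σm_pos)] at h1
  simp at h1

lemma abs_g_mul_futureLikelihood_le (H : M.UniformBounds σm σp G c) (T t : ℕ) (y : X) :
    |M.g t y * M.futureLikelihood T t y| ≤ G ^ (T - t + 1) :=
  abs_mul_forwardIntegral_le M.measurable_g H.abs_g_le _ _ _

lemma integrable_g_mul_futureLikelihood (H : M.UniformBounds σm σp G c) (T t : ℕ) :
    Integrable (fun y => M.g t y * M.futureLikelihood T t y) M.ν := by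
  have := H.isFiniteMeasure_ν
  exact Integrable.mono' (integrable_const _)
    (measurable_g_mul_futureLikelihood T t).aestronglyMeasurable
    (Filter.Eventually.of_forall (H.abs_g_mul_futureLikelihood_le T t))

lemma integral_g_pos (H : M.UniformBounds σm σp G c) {t : ℕ} (ht : 1 ≤ t) :
    0 < ∫ y, M.g t y ∂M.ν := by
  have := H.isFiniteMeasure_ν
  obtain ⟨x⟩ := nonempty M
  have hg : Integrable (M.g t) M.ν := Integrable.mono' (integrable_const G)
    (M.measurable_g t).aestronglyMeasurable (Filter.Eventually.of_forall (H.abs_g_le t))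
  have h1 : ∫ y, M.q x y * M.g t y ∂M.ν ≤ σp * ∫ y, M.g t y ∂M.ν := by
    rw [← integral_const_mul]
    exact integral_mono (integrable_q_mul (M.measurable_g t) (H.abs_g_le t) x) (hg.const_mul _)
      fun y => mul_le_mul_of_nonneg_right (H.q_le x y) (M.g_nonneg t y)
  exact pos_of_mul_pos_right ((H.c_pos.trans_le (H.le_step t ht x)).trans_le h1) H.σp_pos.le

lemma integral_g_mul_futureLikelihood_pos (H : M.UniformBounds σm σp G c) {T t : ℕ} (ht : 1 ≤ t)
    {b : ℝ} (hb : 0 < b) (hl : ∀ x, b ≤ M.futureLikelihood T t x) :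
    0 < ∫ y, M.g t y * M.futureLikelihood T t y ∂M.ν := by
  have := H.isFiniteMeasure_ν
  have hg : Integrable (M.g t) M.ν := Integrable.mono' (integrable_const G)
    (M.measurable_g t).aestronglyMeasurable (Filter.Eventually.of_forall (H.abs_g_le t))
  refine (mul_pos (H.integral_g_pos ht) hb).trans_le ?_
  rw [← integral_mul_const]
  exact integral_mono (hg.mul_const _) (H.integrable_g_mul_futureLikelihood T t)
    fun y => mul_le_mul_of_nonneg_left (hl y) (M.g_nonneg t y)

/-- The future likelihood is comparable to a constant. -/
lemma futureLikelihood_bounds (H : M.UniformBounds σm σp G c) {T t : ℕ} (ht : t ≤ T) :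
    ∃ b, 0 < b ∧ ∀ x, σm / σp * b ≤ M.futureLikelihood T t x ∧ M.futureLikelihood T t x ≤ b := by
  induction ht using Nat.decreasingInduction with
  | self => exact ⟨1, one_pos, fun x => by simp [futureLikelihood_self, H.ratio_le_one]⟩
  | of_succ t ht ih =>
    obtain ⟨b, hb, hl⟩ := ih
    have hpos := H.integral_g_mul_futureLikelihood_pos (Nat.succ_pos t)
      (mul_pos H.ratio_pos hb) fun x => (hl x).1
    have hi := H.integrable_g_mul_futureLikelihood T (t + 1)
    have hnn (y : X) : 0 ≤ M.g (t + 1) y * M.futureLikelihood T (t + 1) y :=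
      mul_nonneg (M.g_nonneg _ _) (futureLikelihood_nonneg _ _ _)
    have hqi (x : X) := integrable_q_mul (M := M) (measurable_g_mul_futureLikelihood T (t + 1))
      (H.abs_g_mul_futureLikelihood_le T (t + 1)) x
    -- By the recursion the future likelihood is an integral of q(x, ·), and q lies between σm and
    -- σp. The ratio of the two bounds is therefore σm / σp at every time and does not accumulate.
    refine ⟨σp * ∫ y, M.g (t + 1) y * M.futureLikelihood T (t + 1) y ∂M.ν,
      mul_pos H.σp_pos hpos, fun x => ?_⟩
    rw [futureLikelihood_eq ht, ← mul_assoc, div_mul_cancel₀ _ H.σp_pos.ne',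
      ← integral_const_mul, ← integral_const_mul]
    exact ⟨integral_mono (hi.const_mul _) (hqi x)
        fun y => mul_le_mul_of_nonneg_right (H.le_q x y) (hnn y),
      integral_mono (hqi x) (hi.const_mul _)
        fun y => mul_le_mul_of_nonneg_right (H.q_le x y) (hnn y)⟩

lemma futureLikelihood_pos (H : M.UniformBounds σm σp G c) {T t : ℕ} (ht : t ≤ T) (x : X) :
    0 < M.futureLikelihood T t x := by
  obtain ⟨b, hb, hl⟩ := H.futureLikelihood_bounds ht
  exact (mul_pos H.ratio_pos hb).trans_le (hl x).1

/-- Forward smoothing forgets its initial state at a geometric rate. -/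
lemma forwardMean_mem_Icc (H : M.UniformBounds σm σp G c) {T s : ℕ} (hs : s ≤ T) {h : X → ℝ}
    (hh : Measurable h) {a o : ℝ} (hao : ∀ x, a ≤ h x ∧ h x ≤ a + o) {d : ℕ} (hd : d ≤ s) :
    ∃ a', ∀ x, a' ≤ M.forwardMean T s h d x ∧
      M.forwardMean T s h d x ≤ a' + (1 - σm / σp) ^ d * o := by
  induction d with
  | zero => exact ⟨a, by simpa [forwardMean] using hao⟩
  | succ d ih =>
    obtain ⟨a', ha'⟩ := ih (by omega)
    obtain ⟨b, hb, hl⟩ := H.futureLikelihood_bounds (T := T) (t := s - d) (by omega)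
    have hpos := H.integral_g_mul_futureLikelihood_pos (t := s - d) (by omega)
      (mul_pos H.ratio_pos hb) fun x => (hl x).1
    have hnn (y : X) : 0 ≤ M.g (s - d) y * M.futureLikelihood T (s - d) y :=
      mul_nonneg (M.g_nonneg _ _) (futureLikelihood_nonneg _ _ _)
    rw [pow_succ', mul_assoc]
    -- A forward step averages against q(x, ·) times a density free of x, so Doeblin's contraction
    -- gives one factor 1 - σm / σp.
    exact exists_average_mem_Icc (u := fun x y => M.q x y *
      (M.g (s - d) y * M.futureLikelihood T (s - d) y)) H.σm_pos H.σm_le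
      (H.integrable_g_mul_futureLikelihood T (s - d)) hpos
      (fun x => ((measurable_q_left x).mul
        (measurable_g_mul_futureLikelihood T (s - d))).aestronglyMeasurable) hnn
      (fun x y => ⟨mul_le_mul_of_nonneg_right (H.le_q x y) (hnn y),
        mul_le_mul_of_nonneg_right (H.q_le x y) (hnn y)⟩)
      (measurable_forwardMean T s hh d).aestronglyMeasurable ha'

lemma exists_abs_forwardMean_le (H : M.UniformBounds σm σp G c) {T s : ℕ} (hs : s ≤ T)
    {h : X → ℝ} (hh : Measurable h) {K : ℝ} (hK : ∀ x, |h x| ≤ K) {d : ℕ} (hd : d ≤ s) :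
    ∃ K', ∀ x, |M.forwardMean T s h d x| ≤ K' := by
  obtain ⟨a', ha'⟩ := H.forwardMean_mem_Icc hs hh (a := -K) (o := 2 * K)
    (fun x => by have := abs_le.1 (hK x); constructor <;> linarith) hd
  refine ⟨|a'| + |a' + (1 - σm / σp) ^ d * (2 * K)|, fun x => abs_le.2 ⟨?_, ?_⟩⟩
  · linarith [neg_abs_le a', abs_nonneg (a' + (1 - σm / σp) ^ d * (2 * K)), (ha' x).1]
  · linarith [le_abs_self (a' + (1 - σm / σp) ^ d * (2 * K)), abs_nonneg a', (ha' x).2]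

/-- The denominator of `forwardMean` is the future likelihood one time earlier, so multiplying by
the latter clears it. -/
lemma futureLikelihood_mul_forwardMean (H : M.UniformBounds σm σp G c) {T s : ℕ} (hs : s ≤ T)
    {h : X → ℝ} {d : ℕ} (hd : d < s) (x : X) :
    M.futureLikelihood T (s - (d + 1)) x * M.forwardMean T s h (d + 1) x
      = ∫ y, M.q x y * (M.g (s - d) y * M.futureLikelihood T (s - d) y) *
          M.forwardMean T s h d y ∂M.ν := by
  have hl := futureLikelihood_eq (M := M) (T := T) (t := s - (d + 1)) (by omega) x
  rw [show s - (d + 1) + 1 = s - d by omega] at hl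
  simp only [forwardMean]
  rw [← hl, mul_div_cancel₀ _ (H.futureLikelihood_pos (by omega) x).ne']

/-- Lets the identification of the smoothing law be proved for nonnegative functions, by lower
Lebesgue integrals, and then be transferred to bounded ones. -/
lemma forwardMean_add_const (H : M.UniformBounds σm σp G c) {T s : ℕ} (hs : s ≤ T) {h : X → ℝ}
    (hh : Measurable h) {K : ℝ} (hK : ∀ x, |h x| ≤ K) (k : ℝ) {d : ℕ} (hd : d ≤ s) (x : X) :
    M.forwardMean T s (fun x => h x + k) d x = M.forwardMean T s h d x + k := by
  induction d generalizing x with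
  | zero => rfl
  | succ d ih =>
    have hl := futureLikelihood_eq (M := M) (T := T) (t := s - (d + 1)) (by omega) x
    rw [show s - (d + 1) + 1 = s - d by omega] at hl
    have hp := H.futureLikelihood_pos (T := T) (t := s - (d + 1)) (by omega) x
    obtain ⟨K', hK'⟩ := H.exists_abs_forwardMean_le hs hh hK (d := d) (by omega)
    have hqi := integrable_q_mul (M := M) (measurable_g_mul_futureLikelihood T (s - d))
      (H.abs_g_mul_futureLikelihood_le T (s - d)) x
    simp only [forwardMean]
    simp_rw [ih (by omega), mul_add]
    rw [integral_add (hqi.mul_bdd (measurable_forwardMean T s hh d).aestronglyMeasurable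
      (Filter.Eventually.of_forall hK')) (hqi.mul_const k), integral_mul_const, ← hl, add_div,
      mul_div_cancel_left₀ _ hp.ne']

/-- Inserting `h` at time `s` multiplies the forward integral by the conditional mean of `h`. -/
lemma forwardIntegral_tilt (H : M.UniformBounds σm σp G c) {T s : ℕ} (hs : s ≤ T) {h : X → ℝ}
    {t : ℕ} (ht : t ≤ T) (x : X) :
    M.forwardIntegral (fun u y => if u = s then M.g u y * h y else M.g u y) (T - t) t x
      = if t < s then M.futureLikelihood T t x * M.forwardMean T s h (s - t) x
        else M.futureLikelihood T t x := by
  induction ht using Nat.decreasingInduction generalizing x with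
  | self => simp [forwardIntegral, futureLikelihood_self, not_lt.2 hs]
  | of_succ t ht ih =>
    rw [show T - t = T - (t + 1) + 1 by omega]
    simp only [forwardIntegral]
    simp_rw [ih]
    rcases lt_or_ge t s with hts | hts
    · rw [if_pos hts]
      obtain ⟨d, rfl⟩ : ∃ d, s = t + 1 + d := ⟨s - (t + 1), by omega⟩
      have hl := H.futureLikelihood_mul_forwardMean hs (h := h) (d := d) (by omega) x
      rw [show t + 1 + d - (d + 1) = t by omega] at hl
      rw [show t + 1 + d - t = d + 1 by omega, hl, show t + 1 + d - d = t + 1 by omega]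
      refine integral_congr_ae (Filter.Eventually.of_forall fun y => ?_)
      -- For d = 0 the next state is the one at time s and `h` comes from the tilted likelihood
      -- itself; for d > 0 it comes from the induction hypothesis.
      rcases Nat.eq_zero_or_pos d with rfl | hd
      · simp [forwardMean]; ring
      · simp only [show t + 1 ≠ t + 1 + d by omega, show t + 1 < t + 1 + d by omega, if_false,
          if_true, show t + 1 + d - (t + 1) = d by omega]
        ring
    · rw [if_neg (not_lt.2 hts), futureLikelihood_eq ht]
      simp only [show t + 1 ≠ s by omega, show ¬ t + 1 < s by omega, if_false]

lemma integral_init_pos (H : M.UniformBounds σm σp G c) (T : ℕ) :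
    0 < ∫ x, M.g 0 x * M.futureLikelihood T 0 x ∂M.χ := by
  have := M.isProbabilityMeasure_χ
  obtain ⟨b, hb, hl⟩ := H.futureLikelihood_bounds (Nat.zero_le T)
  have hg : Integrable (M.g 0) M.χ := Integrable.mono' (integrable_const G)
    (M.measurable_g 0).aestronglyMeasurable (Filter.Eventually.of_forall (H.abs_g_le 0))
  have hgl : Integrable (fun y => M.g 0 y * M.futureLikelihood T 0 y) M.χ :=
    Integrable.mono' (integrable_const _)
      (measurable_g_mul_futureLikelihood T 0).aestronglyMeasurable
      (Filter.Eventually.of_forall (H.abs_g_mul_futureLikelihood_le T 0))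
  refine (mul_pos (H.c_pos.trans_le H.le_init) (mul_pos H.ratio_pos hb)).trans_le ?_
  rw [← integral_mul_const]
  exact integral_mono (hg.mul_const _) hgl
    fun y => mul_le_mul_of_nonneg_left (hl y).1 (M.g_nonneg _ y)

/-- Multiplying the path density by h(x_s) amounts to replacing g_s by g_s h. The path integral then
collapses to a forward integral, evaluated by `forwardIntegral_tilt`. -/
lemma lintegral_unnormalizedSmoothing (H : M.UniformBounds σm σp G c) {T : ℕ} (s : Fin (T + 1))
    {h : X → ℝ} (hh : Measurable h) (hh0 : ∀ x, 0 ≤ h x) {K : ℝ} (hK : ∀ x, h x ≤ K) :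
    ∫⁻ z, ENNReal.ofReal (h (z s)) ∂M.unnormalizedSmoothing T
      = ENNReal.ofReal
          (∫ x, M.g 0 x * M.futureLikelihood T 0 x * M.forwardMean T s h s x ∂M.χ) := by
  have := M.isProbabilityMeasure_χ
  have hσ : ∀ i, SigmaFinite ((Fin.cons M.χ (fun _ => M.ν) : Fin (T + 1) → Measure X) i) := by
    have := M.sigmaFinite_ν
    intro i
    refine Fin.cases ?_ (fun i => ?_) i
    · simp only [Fin.cons_zero]; infer_instance
    · simpa
  obtain ⟨x0⟩ := nonempty M
  have hG : 0 ≤ G := (M.g_nonneg 0 x0).trans (H.g_le 0 x0)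
  have hK0 : 0 ≤ K := (hh0 x0).trans (hK x0)
  set a : ℕ → X → ℝ := fun u y => if u = s then M.g u y * h y else M.g u y with ha
  have ham : ∀ t, Measurable (a t) := fun t => by
    simp only [ha]
    split_ifs
    · exact (M.measurable_g t).mul hh
    · exact M.measurable_g t
  have ha0 : ∀ t x, 0 ≤ a t x := fun t x => by
    simp only [ha]
    split_ifs
    · exact mul_nonneg (M.g_nonneg t x) (hh0 x)
    · exact M.g_nonneg t x
  have haG : ∀ t x, |a t x| ≤ G * (K + 1) := fun t x => by
    rw [abs_of_nonneg (ha0 t x)]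
    simp only [ha]
    split_ifs
    · exact mul_le_mul (H.g_le t x) ((hK x).trans (by linarith)) (hh0 x) hG
    · have := H.g_le t x
      nlinarith
  have hpm : Measurable fun z : Fin (T + 1) → X => M.pathDensity T z := by
    refine (Finset.measurable_prod _ fun u _ => ?_).mul
      (Finset.measurable_prod _ fun u _ => (M.measurable_g _).comp (measurable_pi_apply u))
    have hz : Measurable fun z : Fin (T + 1) → X => (z u.castSucc, z u.succ) :=
      (measurable_pi_apply u.castSucc).prodMk (measurable_pi_apply u.succ)
    exact M.measurable_q.comp hz
  have key := lintegral_pathDensity (M := M) ham ha0 haG T 0 M.χ (f := fun _ => 1) measurable_const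
  have hhm : Measurable fun z : Fin (T + 1) → X => ENNReal.ofReal (h (z s)) :=
    (hh.comp (measurable_pi_apply s)).ennreal_ofReal
  rw [unnormalizedSmoothing, lintegral_withDensity_eq_lintegral_mul _ hpm.ennreal_ofReal hhm]
  have hint (z : Fin (T + 1) → X) : (((fun z => ENNReal.ofReal (M.pathDensity T z)) *
      fun z => ENNReal.ofReal (h (z s))) : (Fin (T + 1) → X) → ENNReal) z
      = 1 * ENNReal.ofReal ((∏ u : Fin T, M.q (z u.castSucc) (z u.succ)) *
        ∏ u : Fin (T + 1), a (0 + u) (z u)) := by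
    rw [Pi.mul_apply, one_mul, ← ENNReal.ofReal_mul' (hh0 _), pathDensity, mul_assoc]
    congr 2
    have h1 (u : Fin (T + 1)) : a (0 + u) (z u) = M.g u (z u) * if u = s then h (z s) else 1 := by
      simp only [ha, zero_add]
      by_cases hu : u = s
      · subst hu; simp
      · simp [hu, Fin.val_inj]
    simp_rw [h1]
    rw [Finset.prod_mul_distrib, Finset.prod_ite_eq' Finset.univ s]
    simp
  simp_rw [hint]
  rw [key]
  have hval (x : X) : a 0 x * M.forwardIntegral a T 0 x
      = M.g 0 x * M.futureLikelihood T 0 x * M.forwardMean T s h s x := by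
    have h1 := H.forwardIntegral_tilt (Nat.lt_succ_iff.1 s.2) (h := h) (Nat.zero_le T) x
    rw [Nat.sub_zero, Nat.sub_zero] at h1
    rw [ha, h1]
    by_cases hs : (s : ℕ) = 0
    · simp [hs, forwardMean]; ring
    · simp only [Ne.symm hs, Nat.pos_of_ne_zero hs, if_false, if_true]; ring
  simp_rw [one_mul, hval]
  rw [ofReal_integral_eq_lintegral_ofReal]
  · refine Integrable.congr (f := fun x => a 0 x * M.forwardIntegral a T 0 x) ?_
      (Filter.Eventually.of_forall hval)
    exact Integrable.mono' (integrable_const _)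
      ((ham 0).mul (measurable_forwardIntegral ham T 0)).aestronglyMeasurable
      (Filter.Eventually.of_forall (abs_mul_forwardIntegral_le ham haG T 0))
  · exact Filter.Eventually.of_forall fun x => by
      exact (mul_nonneg (ha0 0 x) (forwardIntegral_nonneg ha0 _ _ _)).trans_eq (hval x)

/-- The marginal smoothing distribution through the forward recursion. -/
lemma integral_smoothing (H : M.UniformBounds σm σp G c) {T : ℕ} (s : Fin (T + 1))
    {h : X → ℝ} (hh : Measurable h) {K : ℝ} (hK : ∀ x, |h x| ≤ K) :
    ∫ x, h x ∂M.smoothing T s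
      = (∫ x, M.g 0 x * M.futureLikelihood T 0 x * M.forwardMean T s h s x ∂M.χ) /
          ∫ x, M.g 0 x * M.futureLikelihood T 0 x ∂M.χ := by
  have := M.isProbabilityMeasure_χ
  set Z := ∫ x, M.g 0 x * M.futureLikelihood T 0 x ∂M.χ with hZ
  have hZpos : 0 < Z := H.integral_init_pos T
  have hs : (s : ℕ) ≤ T := Nat.lt_succ_iff.1 s.2
  have hgl : Integrable (fun y => M.g 0 y * M.futureLikelihood T 0 y) M.χ :=
    Integrable.mono' (integrable_const _)
      (measurable_g_mul_futureLikelihood T 0).aestronglyMeasurable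
      (Filter.Eventually.of_forall (H.abs_g_mul_futureLikelihood_le T 0))
  have huniv : M.unnormalizedSmoothing T Set.univ = ENNReal.ofReal Z := by
    -- The total mass is the case h = 1, written 0 + 1 so that `forwardMean_add_const` evaluates its
    -- forward mean.
    have h1 := H.lintegral_unnormalizedSmoothing s (h := fun _ => 0 + 1) measurable_const
      (fun _ => by norm_num) (K := 1) (fun _ => by norm_num)
    have h2 (x : X) := H.forwardMean_add_const hs (h := fun _ => 0) measurable_const (K := 0)
      (by simp) 1 le_rfl x
    have h3 (d : ℕ) (x : X) : M.forwardMean T s (fun _ => 0) d x = 0 := by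
      induction d generalizing x with
      | zero => rfl
      | succ d ih => simp [forwardMean, ih]
    simp_rw [h2, h3] at h1
    simpa using h1
  have hsm {f : X → ℝ} (hf : Measurable f) (hf0 : ∀ x, 0 ≤ f x) {L : ℝ} (hL : ∀ x, f x ≤ L) :
      ∫ x, f x ∂M.smoothing T s
        = (∫ x, M.g 0 x * M.futureLikelihood T 0 x * M.forwardMean T s f s x ∂M.χ) / Z := by
    rw [integral_eq_lintegral_of_nonneg_ae (Filter.Eventually.of_forall hf0)
      hf.aestronglyMeasurable, smoothing, lintegral_map hf.ennreal_ofReal (measurable_pi_apply s),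
      jointSmoothing, lintegral_smul_measure, H.lintegral_unnormalizedSmoothing s hf hf0 hL, huniv,
      smul_eq_mul, ENNReal.toReal_mul, ENNReal.toReal_inv, ENNReal.toReal_ofReal hZpos.le,
      ENNReal.toReal_ofReal, inv_mul_eq_div]
    obtain ⟨a', ha'⟩ := H.exists_abs_forwardMean_le hs hf
      (fun x => by rw [abs_of_nonneg (hf0 x)]; exact hL x) le_rfl
    have hnn (d : ℕ) (x : X) : 0 ≤ M.forwardMean T s f d x := by
      induction d generalizing x with
      | zero => exact hf0 x
      | succ d ih =>
        have h1 (y : X) : 0 ≤ M.q x y * (M.g (s - d) y * M.futureLikelihood T (s - d) y) :=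
          mul_nonneg (M.q_nonneg _ _) (mul_nonneg (M.g_nonneg _ _) (futureLikelihood_nonneg _ _ _))
        exact div_nonneg (integral_nonneg fun y => mul_nonneg (h1 y) (ih y)) (integral_nonneg h1)
    exact integral_nonneg fun x => mul_nonneg (mul_nonneg (M.g_nonneg _ _)
      (futureLikelihood_nonneg _ _ _)) (hnn _ x)
  have hprob : IsProbabilityMeasure (M.smoothing T s) := by
    refine ⟨?_⟩
    rw [smoothing, Measure.map_apply (measurable_pi_apply s) MeasurableSet.univ, Set.preimage_univ,
      jointSmoothing, Measure.smul_apply, huniv, smul_eq_mul]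
    exact ENNReal.inv_mul_cancel (by simpa using hZpos) ENNReal.ofReal_ne_top
  -- Shifting by K makes the function nonnegative; the constant cancels at the end.
  have h1 := hsm (f := fun x => h x + K) (hh.add_const K)
    (fun x => by linarith [(abs_le.1 (hK x)).1]) (L := K + K)
    (fun x => by linarith [(abs_le.1 (hK x)).2])
  have hhi : Integrable h (M.smoothing T s) := Integrable.mono' (integrable_const K)
    hh.aestronglyMeasurable (Filter.Eventually.of_forall hK)
  obtain ⟨K', hK'⟩ := H.exists_abs_forwardMean_le hs hh hK le_rfl
  simp_rw [H.forwardMean_add_const hs hh hK K le_rfl, mul_add] at h1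
  rw [integral_add hhi (integrable_const _), integral_add
    (hgl.mul_bdd (measurable_forwardMean T s hh s).aestronglyMeasurable
      (Filter.Eventually.of_forall hK')) (hgl.mul_const K), integral_mul_const, ← hZ, add_div,
    mul_div_cancel_left₀ _ hZpos.ne'] at h1
  simpa using h1

end UniformBounds

end StateSpaceModel

/-! ### Measurability of particle functionals -/

section GenericMeasurability

variable {Ω X : Type*} [MeasurableSpace Ω] [MeasurableSpace X] {N : ℕ}

lemma measurable_eval_label {ξ : Fin N → Ω → X} (hξ : ∀ i, Measurable (ξ i)) :
    Measurable fun p : Ω × Fin N => ξ p.2 p.1 :=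
  measurable_from_prod_countable_left hξ

/-- The σ-field on Ω is left free, here and in the companion lemmas, so that it can be taken to be
the history up to some time. -/
lemma measurable_weighted_average {w : Fin N → Ω → ℝ} {ξ : Fin N → Ω → X}
    (hw : ∀ i, Measurable (w i)) (hξ : ∀ i, Measurable (ξ i)) {ℓ : X → ℝ} (hℓ : Measurable ℓ)
    {k : Ω → X → ℝ} (hk : Measurable (Function.uncurry k)) :
    Measurable fun ω => (∑ i, w i ω * ℓ (ξ i ω) * k ω (ξ i ω)) / ∑ i, w i ω * ℓ (ξ i ω) := by
  have hk' (i : Fin N) : Measurable fun ω => k ω (ξ i ω) :=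
    hk.comp (measurable_id.prodMk (hξ i))
  fun_prop

lemma measurable_kernel_average {w : Fin N → Ω → ℝ} {ξ : Fin N → Ω → X}
    (hw : ∀ i, Measurable (w i)) (hξ : ∀ i, Measurable (ξ i)) {q : X → X → ℝ}
    (hq : Measurable (Function.uncurry q)) {k : Ω → X → ℝ}
    (hk : Measurable (Function.uncurry k)) :
    Measurable (Function.uncurry fun ω x =>
      (∑ i, w i ω * q (ξ i ω) x * k ω (ξ i ω)) / ∑ i, w i ω * q (ξ i ω) x) := by
  have hk' (i : Fin N) : Measurable fun y : Ω × X => k y.1 (ξ i y.1) :=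
    hk.comp (measurable_fst.prodMk ((hξ i).comp measurable_fst))
  have hq' (i : Fin N) : Measurable fun y : Ω × X => q (ξ i y.1) y.2 :=
    hq.comp (((hξ i).comp measurable_fst).prodMk measurable_snd)
  have hw' (i : Fin N) : Measurable fun y : Ω × X => w i y.1 := (hw i).comp measurable_fst
  simp only [Function.uncurry_def]
  fun_prop

lemma measurable_comp_label {ξ : Fin N → Ω → X} (hξ : ∀ i, Measurable (ξ i)) {f : X → X → ℝ}
    (hf : Measurable (Function.uncurry f)) :
    Measurable (Function.uncurry fun (ω : Ω) (z : Fin N × X) => f (ξ z.1 ω) z.2) := by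
  have h1 : Measurable fun y : Ω × (Fin N × X) => (ξ y.2.1 y.1, y.2.2) :=
    ((measurable_eval_label hξ).comp
      (measurable_fst.prodMk (measurable_fst.comp measurable_snd))).prodMk
      (measurable_snd.comp measurable_snd)
  exact hf.comp h1

lemma measurable_comp_snd_snd {k : Ω → X → ℝ} (hk : Measurable (Function.uncurry k)) :
    Measurable (Function.uncurry fun (ω : Ω) (z : Fin N × X) => k ω z.2) :=
  hk.comp (measurable_fst.prodMk (measurable_snd.comp measurable_snd))

lemma measurable_mixture {ν : Measure X} [SFinite ν] {ξ : Fin N → Ω → X}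
    (hξ : ∀ i, Measurable (ξ i)) {a : Fin N → Ω → ENNReal} (ha : ∀ i, Measurable (a i))
    {p : X → X → ENNReal} (hp : Measurable (Function.uncurry p)) {B : Set (Fin N × X)}
    (hB : MeasurableSet B) :
    Measurable fun ω => ((∑ i, a i ω)⁻¹ • ∑ i, a i ω •
      (Measure.dirac i).prod (ν.withDensity (p (ξ i ω)))) B := by
  have h1 (i : Fin N) : Measurable fun ω =>
      ((Measure.dirac i).prod (ν.withDensity (p (ξ i ω)))) B := by
    have h2 (ω : Ω) : ((Measure.dirac i).prod (ν.withDensity (p (ξ i ω)))) B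
        = ∫⁻ y, (Prod.mk i ⁻¹' B).indicator (p (ξ i ω)) y ∂ν := by
      rw [Measure.dirac_prod, Measure.map_apply measurable_prodMk_left hB,
        withDensity_apply _ (measurable_prodMk_left hB),
        lintegral_indicator (measurable_prodMk_left hB)]
    simp_rw [h2]
    have h3 : Measurable fun z : Ω × X => p (ξ i z.1) z.2 :=
      hp.comp (((hξ i).comp measurable_fst).prodMk measurable_snd)
    have h4 : Measurable ((Prod.snd ⁻¹' (Prod.mk i ⁻¹' B)).indicator
        fun z : Ω × X => p (ξ i z.1) z.2) :=
      h3.indicator (measurable_snd (measurable_prodMk_left hB))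
    exact h4.lintegral_prod_right'
  simp only [Measure.smul_apply, Measure.finsetSum_apply, smul_eq_mul]
  exact (Finset.measurable_sum _ fun i _ => ha i).inv.mul
    (Finset.measurable_sum _ fun i _ => (ha i).mul (h1 i))

end GenericMeasurability

/-! ### Importance weights and the instrumental law -/

namespace AuxiliaryDesign

variable {X : Type*} [MeasurableSpace X] {M : StateSpaceModel X} (D : AuxiliaryDesign M)

lemma weightFunZero_nonneg (x : X) : 0 ≤ D.weightFunZero x :=
  mul_nonneg ENNReal.toReal_nonneg (M.g_nonneg _ _)

lemma measurable_weightFunZero : Measurable D.weightFunZero :=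
  (Measure.measurable_rnDeriv _ _).ennreal_toReal.mul (M.measurable_g 0)

lemma weightFun_nonneg {t : ℕ} (ht : 1 ≤ t) (x y : X) : 0 ≤ D.weightFun t x y :=
  div_nonneg (mul_nonneg (M.q_nonneg _ _) (M.g_nonneg _ _))
    (mul_nonneg (D.ϑ_pos t ht x).le (D.p_nonneg t ht x y))

lemma measurable_weightFun {t : ℕ} (ht : 1 ≤ t) :
    Measurable (Function.uncurry (D.weightFun t)) :=
  (M.measurable_q.mul ((M.measurable_g t).comp measurable_snd)).div
    (((D.measurable_ϑ t ht).comp measurable_fst).mul (D.measurable_p t ht))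

/-- Explicit constants for the boundedness of the weights. -/
structure WeightBounds (K W : ℝ) : Prop where
  ϑ_le : ∀ t, 1 ≤ t → ∀ x, D.ϑ t x ≤ K
  weightFunZero_le : ∀ᵐ x ∂D.ρ, D.weightFunZero x ≤ W
  weightFun_le : ∀ t, 1 ≤ t → ∀ x y, D.weightFun t x y ≤ W

end AuxiliaryDesign

namespace ParticleSystem

variable {X : Type*} [MeasurableSpace X] {N : ℕ} {Ω : Type*} [MeasurableSpace Ω]
  {S : ParticleSystem X N Ω} {M : StateSpaceModel X} {D : AuxiliaryDesign M}

lemma weight_nonneg (t : ℕ) (i : Fin N) (ω : Ω) : 0 ≤ S.weight D t i ω := by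
  cases t with
  | zero => exact D.weightFunZero_nonneg _
  | succ t => exact D.weightFun_nonneg (Nat.succ_pos t) _ _

lemma measurable_weight (t : ℕ) (i : Fin N) : Measurable (S.weight D t i) := by
  cases t with
  | zero => exact D.measurable_weightFunZero.comp (S.measurable_ξ 0 i)
  | succ t =>
    have h1 : Measurable fun ω => S.ξ t (S.I (t + 1) i ω) ω :=
      (measurable_eval_label (S.measurable_ξ t)).comp
        (measurable_id.prodMk (S.measurable_I (t + 1) i))
    exact (D.measurable_weightFun (Nat.succ_pos t)).comp (h1.prodMk (S.measurable_ξ (t + 1) i))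

lemma history_le (t : ℕ) : S.history D t ≤ (inferInstance : MeasurableSpace Ω) :=
  iSup_le fun u => iSup_le fun i =>
    ((S.measurable_ξ u i).prodMk (measurable_weight (u : ℕ) i)).comap_le

lemma measurable_pair_history {u t : ℕ} (hu : u ≤ t) (i : Fin N) :
    Measurable[S.history D t] fun ω => (S.ξ u i ω, S.weight D u i ω) := by
  refine measurable_iff_comap_le.2 ?_
  exact le_iSup₂_of_le (f := fun (u : {u : ℕ // u ≤ t}) (i : Fin N) =>
    MeasurableSpace.comap (fun ω => (S.ξ u i ω, S.weight D u i ω)) inferInstance) ⟨u, hu⟩ i le_rfl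

lemma measurable_ξ_history {u t : ℕ} (hu : u ≤ t) (i : Fin N) :
    Measurable[S.history D t] (S.ξ u i) :=
  measurable_fst.comp (measurable_pair_history (D := D) hu i)

lemma measurable_weight_history {u t : ℕ} (hu : u ≤ t) (i : Fin N) :
    Measurable[S.history D t] (S.weight D u i) :=
  measurable_snd.comp (measurable_pair_history hu i)

lemma measurableSet_alive (t : ℕ) : MeasurableSet[S.history D t] {ω | S.Alive D t ω} := by
  have h1 : {ω | S.Alive D t ω} = ⋂ u : {u : ℕ // u ≤ t}, {ω | 0 < S.totalWeight D u ω} := by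
    ext ω
    simp [Alive]
  rw [h1]
  exact MeasurableSet.iInter fun u => measurableSet_lt measurable_const
    (Finset.measurable_sum _ fun i _ => measurable_weight_history u.2 i)

lemma alive_mono {t u : ℕ} (htu : t ≤ u) {ω : Ω} (h : S.Alive D u ω) : S.Alive D t ω :=
  fun v hv => h v (hv.trans htu)

lemma sum_weight_mul_ϑ_pos {t : ℕ} {ω : Ω} (hω : S.Alive D t ω) :
    0 < ∑ i, S.weight D t i ω * D.ϑ (t + 1) (S.ξ t i ω) := by
  have h0 : ∀ i, 0 ≤ S.weight D t i ω := fun i => weight_nonneg t i ω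
  obtain ⟨i, -, hi⟩ := Finset.exists_lt_of_sum_lt
    (s := Finset.univ) (f := fun _ : Fin N => (0 : ℝ)) (g := fun i => S.weight D t i ω)
    (by rw [Finset.sum_const_zero]; exact hω t le_rfl)
  have hϑ (i : Fin N) := D.ϑ_pos (t + 1) (Nat.succ_pos t) (S.ξ t i ω)
  exact Finset.sum_pos' (fun i _ => mul_nonneg (h0 i) (hϑ i).le)
    ⟨i, Finset.mem_univ i, mul_pos hi (hϑ i)⟩

lemma isProbabilityMeasure_withDensity_p {t : ℕ} (ht : 1 ≤ t) (x : X) :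
    IsProbabilityMeasure (M.ν.withDensity fun y => ENNReal.ofReal (D.p t x y)) := by
  refine ⟨?_⟩
  rw [withDensity_apply _ MeasurableSet.univ, Measure.restrict_univ, D.lintegral_p t ht x]

lemma sum_ofReal_weight_mul_ϑ (t : ℕ) (ω : Ω) :
    ∑ i, ENNReal.ofReal (S.weight D t i ω * D.ϑ (t + 1) (S.ξ t i ω))
      = ENNReal.ofReal (∑ i, S.weight D t i ω * D.ϑ (t + 1) (S.ξ t i ω)) :=
  (ENNReal.ofReal_sum_of_nonneg fun i _ => mul_nonneg (weight_nonneg t i ω)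
    (D.ϑ_pos (t + 1) (Nat.succ_pos t) _).le).symm

lemma isProbabilityMeasure_instrumental {t : ℕ} {ω : Ω} (hω : S.Alive D t ω) :
    IsProbabilityMeasure (S.instrumental D t ω) := by
  have hν := M.sigmaFinite_ν
  have hp (x : X) := isProbabilityMeasure_withDensity_p (D := D) (Nat.succ_pos t) x
  refine ⟨?_⟩
  rw [instrumental, Measure.smul_apply, Measure.finsetSum_apply]
  simp only [Measure.smul_apply, measure_univ, smul_eq_mul, mul_one]
  rw [sum_ofReal_weight_mul_ϑ]
  exact ENNReal.inv_mul_cancel (by simpa using sum_weight_mul_ϑ_pos hω) ENNReal.ofReal_ne_top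

lemma measurable_instrumental (t : ℕ) {B : Set (Fin N × X)} (hB : MeasurableSet B) :
    Measurable[S.history D t] fun ω => S.instrumental D t ω B := by
  have hν := M.sigmaFinite_ν
  have ha (i : Fin N) : Measurable[S.history D t]
      fun ω => ENNReal.ofReal (S.weight D t i ω * D.ϑ (t + 1) (S.ξ t i ω)) :=
    ENNReal.measurable_ofReal.comp (Measurable.mul (measurable_weight_history le_rfl i)
      ((D.measurable_ϑ (t + 1) (Nat.succ_pos t)).comp (measurable_ξ_history le_rfl i)))
  exact @measurable_mixture Ω X (S.history D t) _ N M.ν _ (S.ξ t)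
    (fun i => measurable_ξ_history le_rfl i) _ ha (fun x y => ENNReal.ofReal (D.p (t + 1) x y))
    (ENNReal.measurable_ofReal.comp (D.measurable_p (t + 1) (Nat.succ_pos t))) B hB

/-- Means of weighted functions under the instrumental law. -/
lemma integral_instrumental {K W : ℝ} (hD : D.WeightBounds K W) {t : ℕ} {ω : Ω}
    {φ : X → ℝ} (hφ : Measurable φ) {L : ℝ} (hL : ∀ x, |φ x| ≤ L) :
    ∫ z, D.weightFun (t + 1) (S.ξ t z.1 ω) z.2 * φ z.2 ∂S.instrumental D t ω
      = (∑ i, S.weight D t i ω * D.ϑ (t + 1) (S.ξ t i ω))⁻¹ *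
          ∑ i, S.weight D t i ω * ∫ y, M.q (S.ξ t i ω) y * (M.g (t + 1) y * φ y) ∂M.ν := by
  have hν := M.sigmaFinite_ν
  have ht : 1 ≤ t + 1 := Nat.succ_pos t
  have hp (x : X) := isProbabilityMeasure_withDensity_p (D := D) ht x
  have hwm (x : X) : Measurable (D.weightFun (t + 1) x) :=
    (D.measurable_weightFun ht).comp measurable_prodMk_left
  have hpm (x : X) : Measurable fun y => ENNReal.ofReal (D.p (t + 1) x y) :=
    ENNReal.measurable_ofReal.comp ((D.measurable_p (t + 1) ht).comp measurable_prodMk_left)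
  have hfm : Measurable fun z : Fin N × X => D.weightFun (t + 1) (S.ξ t z.1 ω) z.2 * φ z.2 := by
    refine Measurable.mul (measurable_from_prod_countable_right fun i => hwm (S.ξ t i ω))
      (hφ.comp measurable_snd)
  have hfb (z : Fin N × X) : ‖D.weightFun (t + 1) (S.ξ t z.1 ω) z.2 * φ z.2‖ ≤ W * L := by
    rw [norm_mul, Real.norm_of_nonneg (D.weightFun_nonneg ht _ _)]
    exact mul_le_mul (hD.weightFun_le _ ht _ _) (hL _) (norm_nonneg _)
      ((D.weightFun_nonneg ht _ _).trans (hD.weightFun_le _ ht (S.ξ t z.1 ω) z.2))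
  have hwϑ (i : Fin N) : 0 ≤ S.weight D t i ω * D.ϑ (t + 1) (S.ξ t i ω) :=
    mul_nonneg (weight_nonneg t i ω) (D.ϑ_pos (t + 1) ht _).le
  rw [instrumental, integral_smul_measure, sum_ofReal_weight_mul_ϑ, ENNReal.toReal_inv,
    ENNReal.toReal_ofReal (Finset.sum_nonneg fun i _ => hwϑ i), smul_eq_mul,
    integral_finsetSum_measure]
  · congr 1
    refine Finset.sum_congr rfl fun i _ => ?_
    rw [integral_smul_measure, ENNReal.toReal_ofReal (hwϑ i), smul_eq_mul, Measure.dirac_prod,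
      integral_map measurable_prodMk_left.aemeasurable hfm.aestronglyMeasurable,
      integral_withDensity_eq_integral_toReal_smul
        (hpm (S.ξ t i ω))
        (Filter.Eventually.of_forall fun _ => ENNReal.ofReal_lt_top), mul_assoc,
      ← integral_const_mul]
    congr 1
    refine integral_congr_ae ?_
    -- The instrumental density ϑ p cancels the denominator of the weight. Where p vanishes the left
    -- side is 0, and `dominates` makes the right side 0 almost everywhere.
    filter_upwards [D.dominates (t + 1) ht (S.ξ t i ω)] with y hy
    rw [ENNReal.toReal_ofReal (D.p_nonneg _ ht _ _), smul_eq_mul, AuxiliaryDesign.weightFun]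
    have hϑ := (D.ϑ_pos (t + 1) ht (S.ξ t i ω)).ne'
    by_cases hpy : D.p (t + 1) (S.ξ t i ω) y = 0
    · have := hy hpy
      simp only [hpy, zero_mul, mul_zero]
      rw [← mul_assoc, this, zero_mul]
    · field_simp
  · intro i _
    exact Integrable.smul_measure (Integrable.mono' (integrable_const (W * L))
      hfm.aestronglyMeasurable (Filter.Eventually.of_forall hfb)) ENNReal.ofReal_ne_top

end ParticleSystem

lemma abs_le_of_mem_Icc {a b x : ℝ} (h : a ≤ x ∧ x ≤ b) : |x| ≤ |a| + |b| :=
  abs_le.2 ⟨by linarith [neg_abs_le a, abs_nonneg b, h.1],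
    by linarith [le_abs_self b, abs_nonneg a, h.2]⟩

/-! ### Deviation inequality for one generation -/

namespace ParticleSystem

variable {X : Type*} [MeasurableSpace X] {N : ℕ} {Ω : Type*} [MeasurableSpace Ω]
  (S : ParticleSystem X N Ω) {M : StateSpaceModel X} (D : AuxiliaryDesign M)

/-- The average of `k` over the particles at time `t`, weighted by the importance weights and the
likelihood of the future observations. -/
def average (T t : ℕ) (k : Ω → X → ℝ) (ω : Ω) : ℝ :=
  (∑ i, S.weight D t i ω * M.futureLikelihood T t (S.ξ t i ω) * k ω (S.ξ t i ω)) /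
    ∑ i, S.weight D t i ω * M.futureLikelihood T t (S.ξ t i ω)

variable {S D} {σm σp G c K W β ε o : ℝ}

lemma sum_weight_mul_futureLikelihood_pos (H : M.UniformBounds σm σp G c) {T t : ℕ} (ht : t ≤ T)
    {ω : Ω} (hω : 0 < S.totalWeight D t ω) :
    0 < ∑ i, S.weight D t i ω * M.futureLikelihood T t (S.ξ t i ω) := by
  obtain ⟨i, -, hi⟩ := Finset.exists_lt_of_sum_lt
    (s := Finset.univ) (f := fun _ : Fin N => (0 : ℝ)) (g := fun i => S.weight D t i ω)
    (by rw [Finset.sum_const_zero]; exact hω)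
  exact Finset.sum_pos' (fun i _ => mul_nonneg (weight_nonneg t i ω)
    (StateSpaceModel.futureLikelihood_nonneg _ _ _))
    ⟨i, Finset.mem_univ i, mul_pos hi (H.futureLikelihood_pos ht _)⟩

/-- The deviation between the averages before and after a step of the filter. -/
lemma measureReal_step_le (H : M.UniformBounds σm σp G c) (hD : D.WeightBounds K W)
    {P : Measure Ω} [IsProbabilityMeasure P] (hS : S.IsAuxiliaryFilter D P) (hβ : 0 < β)
    (hβK : β * K ≤ c) {T t : ℕ} (ht : t < T) {k0 k1 : Ω → X → ℝ}
    (hk0 : Measurable[(S.history D t).prod inferInstance] (Function.uncurry k0))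
    (hk1 : Measurable[(S.history D t).prod inferInstance] (Function.uncurry k1))
    (hrange : ∀ ω, S.Alive D t ω → ∃ a, ∀ x, a ≤ k1 ω x ∧ k1 ω x ≤ a + o)
    (hid : ∀ ω, S.Alive D t ω →
      ∑ i, S.weight D t i ω * ∫ y, M.q (S.ξ t i ω) y *
          (M.g (t + 1) y * (M.futureLikelihood T (t + 1) y * k1 ω y)) ∂M.ν
        = ∑ i, S.weight D t i ω * M.futureLikelihood T t (S.ξ t i ω) * k0 ω (S.ξ t i ω))
    (hε : 0 < ε) :
    P.real {ω | S.Alive D t ω ∧ 0 < S.totalWeight D (t + 1) ω ∧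
        ε ≤ |S.average D T (t + 1) k1 ω - S.average D T t k0 ω|}
      ≤ deviationBound 3 ((σm / σp) ^ 2 * β ^ 2 / (8 * W ^ 2)) N ε o := by
  have ht1 : 1 ≤ t + 1 := Nat.succ_pos t
  obtain ⟨b, hb, hl⟩ := H.futureLikelihood_bounds (T := T) (t := t + 1) ht
  have hlm := StateSpaceModel.measurable_futureLikelihood (M := M) T (t + 1)
  refine measureReal_cond_importance_sampling_le (E := Fin N × X) (N := N)
    (Z := fun i ω => (S.I (t + 1) i ω, S.ξ (t + 1) i ω)) (κ := S.instrumental D t)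
    (A := {ω | S.Alive D t ω}) (history_le (D := D) t)
    (fun i => (S.measurable_I (t + 1) i).prodMk (S.measurable_ξ (t + 1) i))
    (measurableSet_alive t) (fun ω hω => isProbabilityMeasure_instrumental hω)
    (fun B hB => measurable_instrumental t hB) (hS.step t)
    (w := fun ω z => D.weightFun (t + 1) (S.ξ t z.1 ω) z.2) (k := fun ω z => k1 ω z.2)
    (ℓ := fun z => M.futureLikelihood T (t + 1) z.2) (R := S.average D T t k0)
    (@measurable_comp_label Ω X (S.history D t) _ N (S.ξ t)
      (fun i => measurable_ξ_history le_rfl i) _ (D.measurable_weightFun ht1))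
    (@measurable_comp_snd_snd Ω X (S.history D t) _ N k1 hk1) (hlm.comp measurable_snd)
    (@measurable_weighted_average Ω X (S.history D t) _ N (S.weight D t) (S.ξ t)
      (fun i => measurable_weight_history le_rfl i) (fun i => measurable_ξ_history le_rfl i) _
      (StateSpaceModel.measurable_futureLikelihood T t) k0 hk0)
    (fun ω z => D.weightFun_nonneg ht1 _ _)
    (fun ω _ => Filter.Eventually.of_forall fun z => hD.weightFun_le _ ht1 _ _) hβ ?_
    H.ratio_pos H.ratio_le_one hb (fun z => hl z.2)
    (fun ω hω => (hrange ω hω).imp fun a ha z => ha z.2) ?_ hε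
  -- The mean weight is the ratio of ∑ ω^i ∫ q g dν to ∑ ω^i ϑ(ξ^i). Each integral is at least c and
  -- each ϑ at most K, so β K ≤ c suffices.
  · intro ω hω
    have h1 := integral_instrumental (S := S) hD (t := t) (ω := ω) (φ := fun _ => 1)
      measurable_const (L := 1) (by simp)
    simp only [mul_one] at h1
    rw [h1, inv_mul_eq_div, le_div_iff₀ (sum_weight_mul_ϑ_pos hω), Finset.mul_sum]
    refine Finset.sum_le_sum fun i _ => ?_
    have h2 := H.le_step (t + 1) ht1 (S.ξ t i ω)
    have h3 := mul_le_mul_of_nonneg_left (hD.ϑ_le (t + 1) ht1 (S.ξ t i ω)) hβ.le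
    have h4 := weight_nonneg (S := S) (D := D) t i ω
    calc β * (S.weight D t i ω * D.ϑ (t + 1) (S.ξ t i ω))
        = S.weight D t i ω * (β * D.ϑ (t + 1) (S.ξ t i ω)) := by ring
      _ ≤ _ := mul_le_mul_of_nonneg_left (h3.trans (hβK.trans h2)) h4
  -- The normalising constant of the instrumental law is common to both sides. The numerator is
  -- matched by `hid`, the denominator by the recursion for the future likelihood.
  · intro ω hω
    obtain ⟨a, ha⟩ := hrange ω hω
    have hk1m : Measurable (k1 ω) :=
      hk1.comp (@measurable_prodMk_left _ _ (S.history D t) _ ω)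
    have hlb (x : X) : |M.futureLikelihood T (t + 1) x| ≤ b := by
      rw [abs_of_nonneg (StateSpaceModel.futureLikelihood_nonneg _ _ _)]; exact (hl x).2
    have h1 := integral_instrumental (S := S) hD (t := t) (ω := ω) hlm hlb
    have h2 := integral_instrumental (S := S) hD (t := t) (ω := ω)
      (φ := fun x => M.futureLikelihood T (t + 1) x * k1 ω x) (hlm.mul hk1m)
      (L := b * (|a| + |a + o|)) (fun x => by
        rw [abs_mul]
        exact mul_le_mul (hlb x) (abs_le_of_mem_Icc (ha x)) (abs_nonneg _) hb.le)
    simp only [← mul_assoc] at h1 h2 ⊢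
    have hpos := sum_weight_mul_futureLikelihood_pos (S := S) (D := D) H ht.le (hω t le_rfl)
    have h3 := hid ω hω
    simp only [← mul_assoc] at h3
    rw [h1, h2, h3, average]
    have h4 (i : Fin N) := StateSpaceModel.futureLikelihood_eq (M := M) ht (S.ξ t i ω)
    simp only [← mul_assoc] at h4
    simp_rw [← h4]
    field_simp

/-- The deviation between the average over the initial particles and its limit. -/
lemma measureReal_initial_le (H : M.UniformBounds σm σp G c) (hD : D.WeightBounds K W)
    {P : Measure Ω} [IsProbabilityMeasure P] (hS : S.IsAuxiliaryFilter D P) (hβ : 0 < β)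
    (hβc : β ≤ c) (T : ℕ) {k : X → ℝ} (hk : Measurable k) {a : ℝ}
    (hrange : ∀ x, a ≤ k x ∧ k x ≤ a + o) (hε : 0 < ε) :
    P.real {ω | 0 < S.totalWeight D 0 ω ∧ ε ≤ |S.average D T 0 (fun _ => k) ω -
        (∫ x, M.g 0 x * M.futureLikelihood T 0 x * k x ∂M.χ) /
          ∫ x, M.g 0 x * M.futureLikelihood T 0 x ∂M.χ|}
      ≤ deviationBound 3 ((σm / σp) ^ 2 * β ^ 2 / (8 * W ^ 2)) N ε o := by
  have hρ := D.isProbabilityMeasure_ρ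
  have hχ := M.isProbabilityMeasure_χ
  obtain ⟨b, hb, hl⟩ := H.futureLikelihood_bounds (T := T) (t := 0) (Nat.zero_le T)
  have hlm := StateSpaceModel.measurable_futureLikelihood (M := M) T 0
  have hξ : Measurable fun ω i => S.ξ 0 i ω := measurable_pi_lambda _ (S.measurable_ξ 0)
  have hlaw : P.map (fun ω i => S.ξ 0 i ω) = Measure.pi fun _ : Fin N => D.ρ := by
    refine (Measure.pi_eq fun A hA => ?_).symm
    rw [Measure.map_apply hξ (MeasurableSet.univ_pi hA), ← hS.initial A hA]
    congr 1
    ext ω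
    simp
  -- Change of measure from ρ to χ; with f = 1 it gives the mean weight ∫ g_0 dχ ≥ c.
  have hint (f : X → ℝ) : ∫ x, D.weightFunZero x * f x ∂D.ρ = ∫ x, M.g 0 x * f x ∂M.χ := by
    rw [← integral_rnDeriv_smul D.absolutelyContinuous]
    simp only [AuxiliaryDesign.weightFunZero, smul_eq_mul, mul_assoc]
  have hIS := measureReal_importance_sampling_le (N := N) D.ρ D.measurable_weightFunZero hlm hk
    (R := (∫ x, M.g 0 x * M.futureLikelihood T 0 x * k x ∂M.χ) /
          ∫ x, M.g 0 x * M.futureLikelihood T 0 x ∂M.χ)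
    D.weightFunZero_nonneg hD.weightFunZero_le hβ (by
      have := hint fun _ => 1
      simp only [mul_one] at this
      rw [this]
      exact hβc.trans H.le_init) H.ratio_pos H.ratio_le_one hb hl hrange (by
      simp only [mul_assoc]
      rw [hint, hint, div_mul_cancel₀ _ (H.integral_init_pos T).ne']) hε
  rw [← hlaw, map_measureReal_apply hξ] at hIS
  · exact hIS
  · have hw (i : Fin N) : Measurable fun z : Fin N → X => D.weightFunZero (z i) :=
      D.measurable_weightFunZero.comp (measurable_pi_apply i)
    have h1 : Measurable fun z : Fin N → X => ∑ i, D.weightFunZero (z i) := by fun_prop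
    rw [Set.ofPred_and]
    refine (measurableSet_lt measurable_const h1).inter (measurableSet_le measurable_const ?_)
    fun_prop

end ParticleSystem

/-! ### The interpolating functions: exact before time s, particle based after it -/

namespace ParticleSystem

variable {X : Type*} [MeasurableSpace X] {N : ℕ} {Ω : Type*} [MeasurableSpace Ω]
  (S : ParticleSystem X N Ω) {M : StateSpaceModel X} (D : AuxiliaryDesign M)

/-- The mean of `h` at time `s` under the backward kernels started from the state `x` at
time `s + n`. -/
def backwardMean (s : ℕ) (h : X → ℝ) : ℕ → Ω → X → ℝ
  | 0 => fun _ => h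
  | n + 1 => fun ω x =>
      (∑ i, S.weight D (s + n) i ω * M.q (S.ξ (s + n) i ω) x *
        backwardMean s h n ω (S.ξ (s + n) i ω)) /
        ∑ i, S.weight D (s + n) i ω * M.q (S.ξ (s + n) i ω) x

/-- The mean of `h` at time `s` given the state at time `t`: exact for `t ≤ s`, and approximated by
the particles for `t > s`. -/
def smoothMean (T s : ℕ) (h : X → ℝ) (t : ℕ) (ω : Ω) (x : X) : ℝ :=
  if t ≤ s then M.forwardMean T s h (s - t) x else S.backwardMean D s h (t - s) ω x

variable {S D} {σm σp G c a o : ℝ}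

lemma smoothMean_of_le {T s t : ℕ} (h : X → ℝ) (hts : t ≤ s) (ω : Ω) (x : X) :
    S.smoothMean D T s h t ω x = M.forwardMean T s h (s - t) x := by
  rw [smoothMean, if_pos hts]

lemma smoothMean_of_ge {T s t : ℕ} (h : X → ℝ) (hst : s ≤ t) (ω : Ω) (x : X) :
    S.smoothMean D T s h t ω x = S.backwardMean D s h (t - s) ω x := by
  rcases hst.eq_or_lt with rfl | hlt
  · simp [smoothMean, StateSpaceModel.forwardMean, backwardMean]
  · rw [smoothMean, if_neg (not_le.2 hlt)]

/-- As a function of the state at time s + n, `backwardMean` uses only the generations s, …, s + n -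
1. The function evaluated on generation t + 1 is thus known at time t, which is what allows it to be
frozen when conditioning on the history. -/
lemma measurable_backwardMean {s n t : ℕ} {h : X → ℝ} (hh : Measurable h) (hn : s + n ≤ t + 1) :
    Measurable[(S.history D t).prod inferInstance]
      (Function.uncurry (S.backwardMean D s h n)) := by
  induction n with
  | zero => exact hh.comp (@measurable_snd _ _ (S.history D t) _)
  | succ n ih =>
    exact @measurable_kernel_average Ω X (S.history D t) _ N (S.weight D (s + n)) (S.ξ (s + n))
      (fun i => measurable_weight_history (by omega) i)
      (fun i => measurable_ξ_history (by omega) i) M.q M.measurable_q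
      (S.backwardMean D s h n) (ih (by omega))

lemma measurable_smoothMean {T s t u : ℕ} {h : X → ℝ} (hh : Measurable h) (hu : u ≤ t + 1) :
    Measurable[(S.history D t).prod inferInstance]
      (Function.uncurry (S.smoothMean D T s h u)) := by
  rcases le_or_gt u s with hus | hus
  · have h1 : S.smoothMean D T s h u = fun _ => M.forwardMean T s h (s - u) := by
      ext ω x; exact smoothMean_of_le h hus ω x
    rw [h1]
    exact (StateSpaceModel.measurable_forwardMean T s hh (s - u)).comp
      (@measurable_snd _ _ (S.history D t) _)
  · have h1 : S.smoothMean D T s h u = S.backwardMean D s h (u - s) := by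
      ext ω x; exact smoothMean_of_ge h hus.le ω x
    rw [h1]
    exact measurable_backwardMean hh (by omega)

/-- Backward smoothing forgets its initial state at a geometric rate. -/
lemma backwardMean_mem_Icc (H : M.UniformBounds σm σp G c) {s n : ℕ} {h : X → ℝ}
    (hao : ∀ x, a ≤ h x ∧ h x ≤ a + o) {ω : Ω} (hω : ∀ u < s + n, 0 < S.totalWeight D u ω) :
    ∃ a', ∀ x, a' ≤ S.backwardMean D s h n ω x ∧
      S.backwardMean D s h n ω x ≤ a' + (1 - σm / σp) ^ n * o := by
  induction n with
  | zero => exact ⟨a, by simpa [backwardMean] using hao⟩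
  | succ n ih =>
    obtain ⟨a', ha'⟩ := ih fun u hu => hω u (by omega)
    -- Doeblin's contraction on the set of labels with counting measure: the backward kernel has
    -- density q(ξ^i, x) with respect to the importance weights, again between σm and σp.
    have h1 := exists_average_mem_Icc (μ := Measure.count) (ι := X)
      (u := fun x (i : Fin N) => S.weight D (s + n) i ω * M.q (S.ξ (s + n) i ω) x)
      (v := fun i => S.weight D (s + n) i ω)
      (k := fun i => S.backwardMean D s h n ω (S.ξ (s + n) i ω)) H.σm_pos H.σm_le
      Integrable.of_finite (by rw [integral_count]; exact hω (s + n) (by omega))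
      (fun x => (measurable_of_countable _).aestronglyMeasurable)
      (fun i => weight_nonneg _ _ _)
      (fun x i => ⟨by
          rw [mul_comm]
          exact mul_le_mul_of_nonneg_left (H.le_q _ _) (weight_nonneg _ _ _), by
          rw [mul_comm σp]
          exact mul_le_mul_of_nonneg_left (H.q_le _ _) (weight_nonneg _ _ _)⟩)
      (measurable_of_countable _).aestronglyMeasurable fun i => ha' _
    simp only [integral_count] at h1
    rw [pow_succ', mul_assoc]
    exact h1

/-- Forgetting in both time directions: one of the two truncated differences is 0 and their sum is
|t - s|. Only the weights strictly before t have to be nondegenerate. -/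
lemma smoothMean_mem_Icc (H : M.UniformBounds σm σp G c) {T s t : ℕ} (hs : s ≤ T)
    {h : X → ℝ} (hh : Measurable h) (hao : ∀ x, a ≤ h x ∧ h x ≤ a + o) {ω : Ω}
    (hω : ∀ u < t, 0 < S.totalWeight D u ω) :
    ∃ a', ∀ x, a' ≤ S.smoothMean D T s h t ω x ∧
      S.smoothMean D T s h t ω x ≤ a' + (1 - σm / σp) ^ ((t - s) + (s - t)) * o := by
  rcases le_or_gt t s with hts | hts
  · simp_rw [smoothMean_of_le h hts ω, Nat.sub_eq_zero_of_le hts, Nat.zero_add]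
    exact H.forwardMean_mem_Icc hs hh hao (Nat.sub_le s t)
  · simp_rw [smoothMean_of_ge h hts.le ω, Nat.sub_eq_zero_of_le hts.le, Nat.add_zero]
    exact backwardMean_mem_Icc H hao fun u hu => hω u (by omega)

lemma sum_weight_mul_q_pos (H : M.UniformBounds σm σp G c) {t : ℕ} {ω : Ω}
    (hω : 0 < S.totalWeight D t ω) (x : X) :
    0 < ∑ i, S.weight D t i ω * M.q (S.ξ t i ω) x := by
  refine (mul_pos hω H.σm_pos).trans_le ?_
  rw [totalWeight, Finset.sum_mul]
  exact Finset.sum_le_sum fun i _ =>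
    mul_le_mul_of_nonneg_left (H.le_q _ _) (weight_nonneg _ _ _)

/-- The mean of the weighted average after a step of the filter is the average before it. -/
lemma sum_integral_smoothMean (H : M.UniformBounds σm σp G c) {T s t : ℕ} (hs : s ≤ T)
    (ht : t < T) {h : X → ℝ} (hh : Measurable h) (hao : ∀ x, a ≤ h x ∧ h x ≤ a + o) {ω : Ω}
    (hω : S.Alive D t ω) :
    ∑ i, S.weight D t i ω * ∫ y, M.q (S.ξ t i ω) y * (M.g (t + 1) y *
        (M.futureLikelihood T (t + 1) y * S.smoothMean D T s h (t + 1) ω y)) ∂M.ν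
      = ∑ i, S.weight D t i ω * M.futureLikelihood T t (S.ξ t i ω) *
          S.smoothMean D T s h t ω (S.ξ t i ω) := by
  rcases lt_or_ge t s with hts | hts
  -- Before time s the identity holds particle by particle: it is the forward recursion.
  · refine Finset.sum_congr rfl fun i _ => ?_
    obtain ⟨d, rfl⟩ : ∃ d, s = t + 1 + d := ⟨s - (t + 1), by omega⟩
    simp_rw [smoothMean_of_le h hts.le ω, smoothMean_of_le h hts ω]
    have h1 := H.futureLikelihood_mul_forwardMean hs (h := h) (d := d) (by omega) (S.ξ t i ω)
    rw [show t + 1 + d - (d + 1) = t by omega, show t + 1 + d - d = t + 1 by omega] at h1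
    rw [show t + 1 + d - t = d + 1 by omega, show t + 1 + d - (t + 1) = d by omega, mul_assoc, h1]
    simp only [mul_assoc]
  · have hω' : ∀ u < t + 1, 0 < S.totalWeight D u ω := fun u hu => hω u (by omega)
    obtain ⟨a', ha'⟩ := smoothMean_mem_Icc (t := t + 1) H hs hh hao hω'
    have hkm : Measurable (S.smoothMean D T s h (t + 1) ω) :=
      (measurable_smoothMean (t := t) hh le_rfl).comp
        (@measurable_prodMk_left _ _ (S.history D t) _ ω)
    have hgl := StateSpaceModel.measurable_g_mul_futureLikelihood (M := M) T (t + 1)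
    have hint (x : X) := StateSpaceModel.integrable_q_mul (M := M)
      (φ := fun y => M.g (t + 1) y * M.futureLikelihood T (t + 1) y *
        S.smoothMean D T s h (t + 1) ω y) (hgl.mul hkm)
      (K := G ^ (T - (t + 1) + 1) *
        (|a'| + |a' + (1 - σm / σp) ^ ((t + 1 - s) + (s - (t + 1))) * o|))
      (fun y => by
        rw [abs_mul]
        exact mul_le_mul (H.abs_g_mul_futureLikelihood_le T (t + 1) y)
          (abs_le_of_mem_Icc (ha' y)) (abs_nonneg _)
          ((abs_nonneg _).trans (H.abs_g_mul_futureLikelihood_le T (t + 1) y))) x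
    have hint' (x : X) := StateSpaceModel.integrable_q_mul (M := M) hgl
      (H.abs_g_mul_futureLikelihood_le T (t + 1)) x
    simp only [← mul_assoc] at hint hint' ⊢
    simp_rw [← integral_const_mul]
    rw [← integral_finsetSum _ fun i _ => (hint (S.ξ t i ω)).const_mul _]
    have hl (i : Fin N) : S.weight D t i ω * M.futureLikelihood T t (S.ξ t i ω) *
        S.smoothMean D T s h t ω (S.ξ t i ω)
        = ∫ y, S.weight D t i ω * S.smoothMean D T s h t ω (S.ξ t i ω) *
          (M.q (S.ξ t i ω) y * M.g (t + 1) y * M.futureLikelihood T (t + 1) y) ∂M.ν := by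
      rw [integral_const_mul, StateSpaceModel.futureLikelihood_eq ht]
      simp only [← mul_assoc]
      ring
    simp_rw [hl]
    rw [← integral_finsetSum _ fun i _ => (hint' (S.ξ t i ω)).const_mul _]
    refine integral_congr_ae (Filter.Eventually.of_forall fun y => ?_)
    have hpos := sum_weight_mul_q_pos (S := S) (D := D) H (hω t le_rfl) y
    -- From time s on the identity holds only after summing over the particles: for each y, the
    -- mixture ∑ ω^i q(ξ^i, y) is the denominator of the backward kernel and cancels it.
    have hk : (∑ i, S.weight D t i ω * M.q (S.ξ t i ω) y) * S.smoothMean D T s h (t + 1) ω y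
        = ∑ i, S.weight D t i ω * M.q (S.ξ t i ω) y * S.smoothMean D T s h t ω (S.ξ t i ω) := by
      obtain ⟨n, rfl⟩ : ∃ n, t = s + n := ⟨t - s, by omega⟩
      simp_rw [smoothMean_of_ge h hts ω]
      rw [smoothMean_of_ge h (by omega) ω, show s + n + 1 - s = n + 1 by omega,
        show s + n - s = n by omega, backwardMean, mul_div_cancel₀ _ hpos.ne']
    calc ∑ i, S.weight D t i ω * (M.q (S.ξ t i ω) y * M.g (t + 1) y *
          M.futureLikelihood T (t + 1) y * S.smoothMean D T s h (t + 1) ω y)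
        = (∑ i, S.weight D t i ω * M.q (S.ξ t i ω) y) * S.smoothMean D T s h (t + 1) ω y *
            (M.g (t + 1) y * M.futureLikelihood T (t + 1) y) := by
          rw [Finset.sum_mul, Finset.sum_mul]
          exact Finset.sum_congr rfl fun i _ => by ring
      _ = _ := by
          rw [hk, Finset.sum_mul]
          exact Finset.sum_congr rfl fun i _ => by ring

lemma sum_backward (H : M.UniformBounds σm σp G c) {t : ℕ} {ω : Ω}
    (hω : 0 < S.totalWeight D t ω) (j : Fin N) : ∑ i, S.backward D t j i ω = 1 := by
  simp only [backward]
  rw [← Finset.sum_div, div_self (sum_weight_mul_q_pos H hω _).ne']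

/-- The backward probabilities depend on the label j only through the position of particle j, so
averages over labels are values of a function on the state space. -/
lemma backwardAverage_eq_backwardMean (s : ℕ) (h : X → ℝ) (n : ℕ) (ω : Ω) (j : Fin N) :
    backwardAverage (fun k j i => S.backward D (s + k) j i ω) (fun i => h (S.ξ s i ω)) n j
      = S.backwardMean D s h n ω (S.ξ (s + n) j ω) := by
  induction n generalizing j with
  | zero => rfl
  | succ n ih =>
    simp only [backwardAverage, ih]
    simp only [backwardMean, backward]
    rw [Finset.sum_div]
    exact Finset.sum_congr rfl fun i _ => by rw [div_mul_eq_mul_div]; rfl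

end ParticleSystem

/-! ### The two estimators -/

namespace ParticleSystem

variable {X : Type*} [MeasurableSpace X] {N : ℕ} {Ω : Type*} [MeasurableSpace Ω]
  {S : ParticleSystem X N Ω} {M : StateSpaceModel X} {D : AuxiliaryDesign M}
  {σm σp G c K W β ε a o : ℝ}

/-- The FFBSm estimator as an average over the final particles. -/
lemma ffbsm_eq_average {T s : ℕ} (hs : s ≤ T) (h : X → ℝ) (ω : Ω) :
    S.ffbsm D s T h ω = S.average D T T (S.smoothMean D T s h T) ω := by
  have h1 := sum_path_eq (fun k j i => S.backward D (s + k) j i ω) (fun i => h (S.ξ s i ω)) (T - s)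
    (fun i => S.weight D T i ω / S.totalWeight D T ω)
  rw [ffbsm]
  simp only [pathWeight]
  rw [h1, average]
  simp_rw [backwardAverage_eq_backwardMean, StateSpaceModel.futureLikelihood_self, mul_one,
    smoothMean_of_ge h hs ω, show s + (T - s) = T by omega]
  rw [Finset.sum_div]
  exact Finset.sum_congr rfl fun i _ => by rw [totalWeight]; ring

lemma pathWeight_nonneg (s T : ℕ) (i : Fin (T - s + 1) → Fin N) (ω : Ω) :
    0 ≤ S.pathWeight D s T i ω := by
  have hw := fun t i => weight_nonneg (S := S) (D := D) t i ω
  refine mul_nonneg (Finset.prod_nonneg fun k _ => div_nonneg (mul_nonneg (hw _ _)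
    (M.q_nonneg _ _)) (Finset.sum_nonneg fun l _ => mul_nonneg (hw _ _) (M.q_nonneg _ _)))
    (div_nonneg (hw _ _) (Finset.sum_nonneg fun l _ => hw _ _))

/-- Under the law of a backward index path, the mean of `h` at time `s` is the FFBSm
estimator. -/
lemma sum_pathWeight_mul (H : M.UniformBounds σm σp G c) {T : ℕ} (s : Fin (T + 1)) (h : X → ℝ)
    {ω : Ω} (hω : S.Alive D T ω) :
    ∑ j : Fin (T + 1) → Fin N, S.pathWeight D 0 T j ω * h (S.ξ s (j s) ω) = S.ffbsm D s T h ω := by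
  have hB : ∀ k < T, ∀ j, ∑ i, S.backward D (0 + k) j i ω = 1 := fun k hk j => by
    rw [Nat.zero_add]; exact sum_backward H (hω k hk.le) j
  -- The indices before s are summed out, the backward matrices being stochastic; what remains is
  -- the path sum of FFBSm.
  have h1 := sum_path_apply_eq (fun i => h (S.ξ s i ω)) T hB s
    (fun i => S.weight D T i ω / S.totalWeight D T ω)
  have h2 := sum_path_eq (fun k j i => S.backward D (s + k) j i ω) (fun i => h (S.ξ s i ω)) (T - s)
    (fun i => S.weight D T i ω / S.totalWeight D T ω)
  rw [ffbsm]
  simp only [pathWeight]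
  rw [h2]
  refine Eq.trans h1 ?_
  simp_rw [Nat.zero_add]

lemma sum_pathWeight (H : M.UniformBounds σm σp G c) {T : ℕ} {ω : Ω} (hω : S.Alive D T ω) :
    ∑ j : Fin (T + 1) → Fin N, S.pathWeight D 0 T j ω = 1 := by
  have hB : ∀ k < T, ∀ j, ∑ i, S.backward D (0 + k) j i ω = 1 := fun k hk j => by
    rw [Nat.zero_add]; exact sum_backward H (hω k hk.le) j
  have h1 := sum_path_eq (fun k j i => S.backward D (0 + k) j i ω) (fun _ => 1) T
    (fun i => S.weight D T i ω / S.totalWeight D T ω)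
  simp_rw [backwardAverage_one hB, mul_one] at h1
  refine Eq.trans h1 ?_
  rw [← Finset.sum_div]
  exact div_self (hω T le_rfl).ne'

lemma measurable_backward_history {t T : ℕ} (ht : t < T) (j i : Fin N) :
    Measurable[S.history D T] (S.backward D t j i) := by
  have hq (l : Fin N) : Measurable[S.history D T]
      fun ω => S.weight D t l ω * M.q (S.ξ t l ω) (S.ξ (t + 1) j ω) :=
    Measurable.mul (measurable_weight_history ht.le l)
      (M.measurable_q.comp ((measurable_ξ_history (D := D) ht.le l).prodMk
        (measurable_ξ_history (D := D) (Nat.succ_le_of_lt ht) j)))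
  exact Measurable.div (hq i) (Finset.measurable_sum _ fun l _ => hq l)

lemma measurable_pathWeight_history (T : ℕ) (j : Fin (T + 1) → Fin N) :
    Measurable[S.history D T] (S.pathWeight D 0 T j) := by
  refine Measurable.mul (Finset.measurable_prod _ fun k _ => ?_) (Measurable.div
    (measurable_weight_history le_rfl _)
    (Finset.measurable_sum _ fun l _ => measurable_weight_history le_rfl l))
  exact measurable_backward_history (by have := k.2; omega) _ _

/-- The law of a backward index path given the particles. -/
def pathLaw (S : ParticleSystem X N Ω) (D : AuxiliaryDesign M) (T : ℕ) (ω : Ω) :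
    Measure (Fin (T + 1) → Fin N) :=
  ∑ j : Fin (T + 1) → Fin N, ENNReal.ofReal (S.pathWeight D 0 T j ω) • Measure.dirac j

lemma integral_pathLaw (T : ℕ) (ω : Ω) (f : (Fin (T + 1) → Fin N) → ℝ) :
    ∫ j, f j ∂S.pathLaw D T ω = ∑ j, S.pathWeight D 0 T j ω * f j := by
  rw [pathLaw, integral_finsetSum_measure]
  · refine Finset.sum_congr rfl fun j _ => ?_
    rw [integral_smul_measure, integral_dirac, ENNReal.toReal_ofReal (pathWeight_nonneg 0 T j ω),
      smul_eq_mul]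
  · intro j _
    exact Integrable.smul_measure (integrable_dirac (by simp)) ENNReal.ofReal_ne_top

open Classical in
lemma pathLaw_real_apply (T : ℕ) (ω : Ω) (B : Set (Fin (T + 1) → Fin N)) :
    (S.pathLaw D T ω).real B = ∑ j, if j ∈ B then S.pathWeight D 0 T j ω else 0 := by
  have hB : MeasurableSet B := B.toFinite.measurableSet
  have h1 := integral_pathLaw (S := S) (D := D) T ω (B.indicator 1)
  rw [integral_indicator_one hB] at h1
  rw [h1]
  exact Finset.sum_congr rfl fun j _ => by simp [Set.indicator_apply]

lemma isProbabilityMeasure_pathLaw (H : M.UniformBounds σm σp G c) {T : ℕ} {ω : Ω}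
    (hω : S.Alive D T ω) : IsProbabilityMeasure (S.pathLaw D T ω) := by
  refine ⟨?_⟩
  simp only [pathLaw, Measure.finsetSum_apply, Measure.smul_apply, measure_univ, smul_eq_mul,
    mul_one]
  refine (ENNReal.ofReal_sum_of_nonneg fun j _ => pathWeight_nonneg 0 T j ω).symm.trans ?_
  exact (congrArg ENNReal.ofReal (sum_pathWeight H hω)).trans ENNReal.ofReal_one

/-- Given the particles, the index paths are i.i.d. -/
lemma IsFFBSi.cond_law {P : Measure Ω} [IsProbabilityMeasure P] {T : ℕ}
    {J : Fin N → Fin (T + 1) → Ω → Fin N} (hJ : S.IsFFBSi D P T J)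
    (B : Fin N → Set (Fin (T + 1) → Fin N)) :
    ∀ᵐ ω ∂P, S.Alive D T ω →
      (P⟦{ω' | ∀ l, (fun t => J l t ω') ∈ B l} | S.history D T⟧) ω
        = ∏ l, (S.pathLaw D T ω).real (B l) := by
  classical
  -- The event is a finite disjoint union of atoms, one for each array of index paths. Conditional
  -- probabilities add up, and the sum of products over arrays factorises into a product over l.
  let F : Finset (Fin N → Fin (T + 1) → Fin N) := Finset.univ.filter fun j => ∀ l, j l ∈ B l
  have hmeas (j : Fin N → Fin (T + 1) → Fin N) : MeasurableSet {ω' | ∀ l t, J l t ω' = j l t} := by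
    simp only [Set.ofPred_forall]
    exact MeasurableSet.iInter fun l => MeasurableSet.iInter fun t =>
      hJ.measurable_J l t (measurableSet_singleton _)
  have hset : ({ω' | ∀ l, (fun t => J l t ω') ∈ B l}.indicator fun _ => (1 : ℝ))
      = ∑ j ∈ F, {ω' | ∀ l t, J l t ω' = j l t}.indicator fun _ => (1 : ℝ) := by
    ext ω
    rw [Finset.sum_apply]
    have h1 (j : Fin N → Fin (T + 1) → Fin N) :
        {ω' | ∀ l t, J l t ω' = j l t}.indicator (fun _ => (1 : ℝ)) ω
          = if (fun l t => J l t ω) = j then 1 else 0 := by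
      simp [Set.indicator_apply, funext_iff]
    simp_rw [h1]
    rw [Finset.sum_ite_eq]
    simp [Set.indicator_apply, F]
  have hsum := condExp_finsetSum (μ := P) (s := F)
    (f := fun (j : Fin N → Fin (T + 1) → Fin N) => {ω' | ∀ l t, J l t ω' = j l t}.indicator fun _ => (1 : ℝ))
    (fun j _ => (integrable_const _).indicator (hmeas j)) (S.history D T)
  have hlaw : ∀ᵐ ω ∂P, ∀ j : Fin N → Fin (T + 1) → Fin N, S.Alive D T ω →
      (P⟦{ω' | ∀ l t, J l t ω' = j l t} | S.history D T⟧) ω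
        = ∏ l, S.pathWeight D 0 T (j l) ω := ae_all_iff.2 hJ.law
  filter_upwards [hsum, hlaw] with ω h1 h2 hω
  rw [hset, h1, Finset.sum_apply, Finset.sum_congr rfl fun j _ => h2 j hω]
  simp_rw [pathLaw_real_apply]
  rw [Finset.prod_univ_sum, Fintype.piFinset_univ]
  rw [Finset.sum_filter]
  exact Finset.sum_congr rfl fun j _ => by rw [Finset.prod_ite_zero]; simp

/-- The deviation between the FFBSi and the FFBSm estimators. -/
lemma measureReal_ffbsi_sub_ffbsm_le (H : M.UniformBounds σm σp G c) {P : Measure Ω}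
    [IsProbabilityMeasure P] {T : ℕ} {J : Fin N → Fin (T + 1) → Ω → Fin N}
    (hJ : S.IsFFBSi D P T J) (s : Fin (T + 1)) {h : X → ℝ} (hh : Measurable h)
    (hao : ∀ x, a ≤ h x ∧ h x ≤ a + o) (hε : 0 < ε) :
    P.real {ω | S.Alive D T ω ∧ ε ≤ |S.ffbsi T J s h ω - S.ffbsm D s T h ω|}
      ≤ deviationBound 3 (1 / 8) N ε o := by
  have hs : (s : ℕ) ≤ T := Nat.lt_succ_iff.1 s.2
  have hR : (fun ω => S.ffbsm D s T h ω) = S.average D T T (S.smoothMean D T s h T) :=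
    funext fun ω => ffbsm_eq_average hs h ω
  have hRm : Measurable[S.history D T] fun ω => S.ffbsm D s T h ω := by
    rw [hR]
    exact @measurable_weighted_average Ω X (S.history D T) _ N (S.weight D T) (S.ξ T)
      (fun i => measurable_weight_history le_rfl i) (fun i => measurable_ξ_history le_rfl i) _
      (StateSpaceModel.measurable_futureLikelihood T T) _ (measurable_smoothMean hh (Nat.le_succ T))
  -- Unweighted sampling is the case w = ℓ = 1, where every constant is 1 and the rate is 1 / 8.
  have hmain := measureReal_cond_importance_sampling_le (P := P) (N := N) (ε := ε)
    (E := Fin (T + 1) → Fin N) (Z := fun l ω t => J l t ω) (κ := S.pathLaw D T)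
    (A := {ω | S.Alive D T ω}) (history_le (D := D) T)
    (fun l => measurable_pi_lambda _ fun t => hJ.measurable_J l t)
    (measurableSet_alive T) (fun ω hω => isProbabilityMeasure_pathLaw H hω)
    (fun B hB => by
      simp only [pathLaw, Measure.finsetSum_apply, Measure.smul_apply, smul_eq_mul]
      exact Finset.measurable_sum _ fun j _ =>
        (ENNReal.measurable_ofReal.comp (measurable_pathWeight_history T j)).mul_const _)
    (fun B _ => hJ.cond_law B)
    (w := fun _ _ => 1) (k := fun ω j => h (S.ξ s (j s) ω)) (ℓ := fun _ => 1)
    (R := fun ω => S.ffbsm D s T h ω) measurable_const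
    (@measurable_from_prod_countable_left _ _ _ (S.history D T) _ _ _ _ _
      fun j => hh.comp (measurable_ξ_history (D := D) hs (j s)))
    measurable_const hRm (W := 1) (β := 1) (lam := 1) (b := 1) (c := o)
    (fun _ _ => zero_le_one) (fun _ _ => Filter.Eventually.of_forall fun _ => le_rfl) one_pos
    (fun ω hω => by
      have := isProbabilityMeasure_pathLaw H hω
      simp) one_pos le_rfl one_pos (fun _ => by simp)
    (fun ω _ => ⟨a, fun j => hao _⟩)
    (fun ω hω => by
      have := isProbabilityMeasure_pathLaw H hω
      simp only [one_mul]
      refine (integral_pathLaw T ω _).trans ((sum_pathWeight_mul H s h hω).trans ?_)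
      simp) hε
  norm_num at hmain ⊢
  refine (measureReal_mono ?_).trans hmain
  rintro ω ⟨hω, hω'⟩
  refine ⟨hω, ?_, hω'⟩
  -- The sum of the unit weights is N, and N = 0 is excluded because a total weight is positive.
  rcases Nat.eq_zero_or_pos N with rfl | hN
  · have := hω T le_rfl
    simp [totalWeight] at this
  · exact hN

/-- The deviation of the FFBSm estimator. -/
lemma measureReal_ffbsm_le (H : M.UniformBounds σm σp G c) (hD : D.WeightBounds K W)
    {P : Measure Ω} [IsProbabilityMeasure P] (hS : S.IsAuxiliaryFilter D P) (hβ : 0 < β)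
    (hβc : β ≤ c) (hβK : β * K ≤ c) (hW : 0 < W) {T : ℕ} (s : Fin (T + 1)) {h : X → ℝ}
    (hh : Measurable h) (ho : 0 ≤ o) (hao : ∀ x, a ≤ h x ∧ h x ≤ a + o) (hε : 0 < ε) :
    P.real {ω | S.Alive D T ω ∧ ε ≤ |S.ffbsm D s T h ω - ∫ x, h x ∂M.smoothing T s|}
      ≤ deviationBound (6 / (1 - Real.exp (-(1 - (1 - σm / σp / 2)))) + Real.exp 1)
        ((σm / σp) ^ 2 * β ^ 2 / (8 * W ^ 2) * ((1 - (1 - σm / σp / 2)) / 2) ^ 2) N ε o := by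
  have hs : (s : ℕ) ≤ T := Nat.lt_succ_iff.1 s.2
  have hlam := H.ratio_pos
  have hlam1 := H.ratio_le_one
  -- Shifted by one: index 0 is the exact value and index t + 1 belongs to generation t. The
  -- increment from u to u + 1 is the sampling error of generation u, and there are T + 1 of them.
  let R : ℕ → Ω → ℝ := fun u ω => match u with
    | 0 => ∫ x, h x ∂M.smoothing T s
    | t + 1 => S.average D T t (S.smoothMean D T s h t) ω
  have hrange {t : ℕ} {ω : Ω} (hω : ∀ u < t, 0 < S.totalWeight D u ω) :
      ∃ a', ∀ x, a' ≤ S.smoothMean D T s h t ω x ∧ S.smoothMean D T s h t ω x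
        ≤ a' + (1 - σm / σp / 2) ^ (2 * ((t - s) + (s - t))) * o := by
    obtain ⟨a', ha'⟩ := smoothMean_mem_Icc H hs hh hao hω
    refine ⟨a', fun x => ⟨(ha' x).1, (ha' x).2.trans ?_⟩⟩
    -- With λ = σm / σp, the rate r = 1 - λ / 2 satisfies r² ≥ 1 - λ. The contraction (1 - λ)^|t -
    -- s| is thus put in the form r^(2|t - s|) needed for telescoping.
    rw [pow_mul]
    gcongr
    nlinarith [sq_nonneg (σm / σp)]
  have htel := measureReal_telescope_le (P := P) (A := {ω | S.Alive D T ω}) (R := R)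
    (C := (σm / σp) ^ 2 * β ^ 2 / (8 * W ^ 2)) (r := 1 - σm / σp / 2) (o := o) (N := N) (s := s)
    (T := T + 1) (by positivity) (by linarith) (by linarith) (fun u hu ε hε => ?_) hε
  · refine (measureReal_mono ?_).trans htel
    rintro ω ⟨hω, hω'⟩
    refine ⟨hω, ?_⟩
    simp only [R]
    rwa [ffbsm_eq_average hs] at hω'
  · cases u with
    | zero =>
      obtain ⟨ω0⟩ : Nonempty Ω := P.nonempty_of_neZero
      obtain ⟨a', ha'⟩ := hrange (t := 0) (ω := ω0) (by simp)
      have hk : S.smoothMean D T s h 0 = fun _ => M.forwardMean T s h s := by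
        ext ω x; exact smoothMean_of_le h (Nat.zero_le _) ω x
      rw [hk] at ha'
      have h1 := measureReal_initial_le H hD hS hβ hβc T
        (StateSpaceModel.measurable_forwardMean T s hh s) ha' hε
      refine (measureReal_mono ?_).trans h1
      rintro ω ⟨hω, hω'⟩
      refine ⟨hω 0 (Nat.zero_le T), ?_⟩
      simp only [R, hk] at hω'
      rwa [H.integral_smoothing s hh fun x => abs_le_of_mem_Icc (hao x)] at hω'
    | succ t =>
      have ht : t < T := by omega
      have h1 := measureReal_step_le H hD hS hβ hβK ht (k0 := S.smoothMean D T s h t)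
        (k1 := S.smoothMean D T s h (t + 1)) (measurable_smoothMean hh (by omega))
        (measurable_smoothMean hh le_rfl)
        (fun ω hω => hrange fun u hu => hω u (by omega))
        (fun ω hω => sum_integral_smoothMean H hs ht hh hao hω) hε
      refine (measureReal_mono ?_).trans h1
      rintro ω ⟨hω, hω'⟩
      exact ⟨alive_mono ht.le hω, hω (t + 1) ht, hω'⟩

end ParticleSystem

lemma exists_mem_Icc_osc {X : Type*} [Nonempty X] {h : X → ℝ} (hb : ∃ K : ℝ, ∀ x, |h x| ≤ K) :
    ∃ a, ∀ x, a ≤ h x ∧ h x ≤ a + osc h := by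
  obtain ⟨K, hK⟩ := hb
  have hbdd : BddAbove (Set.range fun z : X × X => |h z.1 - h z.2|) := by
    refine ⟨2 * K, ?_⟩
    rintro _ ⟨z, rfl⟩
    have h1 := abs_le.1 (hK z.1)
    have h2 := abs_le.1 (hK z.2)
    exact abs_le.2 ⟨by linarith, by linarith⟩
  have hbelow : BddBelow (Set.range h) := by
    refine ⟨-K, ?_⟩
    rintro _ ⟨x, rfl⟩
    exact (abs_le.1 (hK x)).1
  refine ⟨⨅ x, h x, fun x => ⟨ciInf_le hbelow x, ?_⟩⟩
  have h1 : h x - osc h ≤ ⨅ y, h y := le_ciInf fun y => by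
    have h2 : |h x - h y| ≤ osc h := le_ciSup hbdd (x, y)
    linarith [le_abs_self (h x - h y)]
  linarith

lemma osc_nonneg {X : Type*} (h : X → ℝ) : 0 ≤ osc h :=
  Real.iSup_nonneg fun _ => abs_nonneg _

lemma deviationBound_mono {B B' C C' ε o : ℝ} {N : ℕ} (hB : B ≤ B') (hB' : 0 ≤ B') (hC : C' ≤ C) :
    deviationBound B C N ε o ≤ deviationBound B' C' N ε o := by
  unfold deviationBound
  split_ifs
  · exact le_rfl
  · gcongr

/-- Halving the threshold divides the exponent by 4. -/
lemma deviationBound_half_add_le {B B' C C' C'' ε o : ℝ} {N : ℕ} (hB : 0 ≤ B) (hB' : 0 ≤ B')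
    (hC : C'' ≤ C / 4) (hC' : C'' ≤ C' / 4) :
    deviationBound B C N (ε / 2) o + deviationBound B' C' N (ε / 2) o
      ≤ deviationBound (B + B') C'' N ε o := by
  have key (A : ℝ) : deviationBound A C'' N ε o
      = if o = 0 then 0 else A * Real.exp (-((4 * C'') * N * (ε / 2) ^ 2 / o ^ 2)) := by
    unfold deviationBound
    congr 4
    ring
  rw [key]
  unfold deviationBound
  split_ifs
  · simp
  · rw [add_mul]
    have h1 : 4 * C'' ≤ C := by linarith
    have h2 : 4 * C'' ≤ C' := by linarith
    gcongr

end

/-! ### Choice of the constants -/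

theorem mainTheorem3 {X : Type*} [TopologicalSpace X] [PolishSpace X] [MeasurableSpace X]
    [BorelSpace X] (M : StateSpaceModel X) (D : AuxiliaryDesign M)
    (hA1 : M.BoundedLikelihood) (hA2 : D.BoundedWeights) (hA4 : M.StrongMixing) :
    ∃ B C : ℝ, 0 < B ∧ 0 < C ∧
      ∀ (N : ℕ), 1 ≤ N →
      ∀ (Ω : Type*) [MeasurableSpace Ω] (P : Measure Ω) [IsProbabilityMeasure P]
        (S : ParticleSystem X N Ω), S.IsAuxiliaryFilter D P →
      ∀ (T : ℕ) (s : Fin (T + 1)) (h : X → ℝ), Measurable h → (∃ K : ℝ, ∀ x, |h x| ≤ K) →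
      ∀ ε : ℝ, 0 < ε →
        P.real {ω | S.Alive D T ω ∧
            ε ≤ |S.ffbsm D s T h ω - ∫ x, h x ∂(M.smoothing T s)|}
          ≤ deviationBound B C N ε (osc h) ∧
        ∀ J : Fin N → Fin (T + 1) → Ω → Fin N, S.IsFFBSi D P T J →
          P.real {ω | S.Alive D T ω ∧
              ε ≤ |S.ffbsi T J s h ω - ∫ x, h x ∂(M.smoothing T s)|}
            ≤ deviationBound B C N ε (osc h) := by
  obtain ⟨G, hG⟩ := hA1
  obtain ⟨⟨K, hK⟩, W, hW0, hW⟩ := hA2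
  obtain ⟨⟨σm, σp, hσm, hσ, hq⟩, c, hc, hc0, hct⟩ := hA4
  have H : M.UniformBounds σm σp G c :=
    ⟨hσm, hσ, fun x y => (hq x y).1, fun x y => (hq x y).2, hG, hc, hc0, hct⟩
  -- The maxima with 1 make both bounds positive and give β ≤ c below.
  have hD : D.WeightBounds (max K 1) (max W 1) :=
    ⟨fun t ht x => (hK t ht x).trans (le_max_left _ _),
      hW0.mono fun x hx => hx.trans (le_max_left _ _),
      fun t ht x y => (hW t ht x y).trans (le_max_left _ _)⟩
  have hK1 : 1 ≤ max K 1 := le_max_right _ _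
  have hW1 : 0 < max W 1 := one_pos.trans_le (le_max_right _ _)
  have hX := StateSpaceModel.UniformBounds.nonempty M
  have hlam := H.ratio_pos
  -- One lower bound for the mean weight at all times: c at time 0, and c divided by the bound on ϑ
  -- afterwards.
  set β := c / max K 1 with hβ
  have hβ0 : 0 < β := div_pos hc (by linarith)
  have hβc : β ≤ c := div_le_self hc.le hK1
  have hβK : β * max K 1 ≤ c := (div_mul_cancel₀ c (by linarith)).le
  set B := 6 / (1 - Real.exp (-(1 - (1 - σm / σp / 2)))) + Real.exp 1 with hB
  set C := (σm / σp) ^ 2 * β ^ 2 / (8 * max W 1 ^ 2) * ((1 - (1 - σm / σp / 2)) / 2) ^ 2 with hC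
  have hB0 : 0 < B := by
    have : Real.exp (-(1 - (1 - σm / σp / 2))) < 1 := Real.exp_lt_one_iff.2 (by linarith)
    have h1 : 0 < 1 - Real.exp (-(1 - (1 - σm / σp / 2))) := by linarith
    positivity
  have hC0 : 0 < C := by
    have : 0 < 1 - (1 - σm / σp / 2) := by linarith
    positivity
  -- The FFBSi error is split into ε / 2 for FFBSm, with constants B and C, and ε / 2 for the index
  -- paths, with constants 3 and 1 / 8.
  refine ⟨B + 3, min (C / 4) (1 / 8 / 4), by linarith, lt_min (by linarith) (by norm_num), ?_⟩
  intro N _ Ω _ P _ S hS T s h hh hb ε hε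
  obtain ⟨a, hao⟩ := exists_mem_Icc_osc hb
  have hm {δ : ℝ} (hδ : 0 < δ) := ParticleSystem.measureReal_ffbsm_le H hD hS hβ0 hβc hβK hW1 s hh
    (osc_nonneg h) hao hδ
  refine ⟨(hm hε).trans (deviationBound_mono (by linarith) (by linarith)
    ((min_le_left _ _).trans (by linarith))), fun J hJ => ?_⟩
  have hi := ParticleSystem.measureReal_ffbsi_sub_ffbsm_le H hJ s hh hao (half_pos hε)
  refine le_trans ?_ (deviationBound_half_add_le hB0.le (by norm_num) (min_le_left _ _)
    (min_le_right _ _))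
  refine le_trans ?_ (add_le_add (hm (half_pos hε)) hi)
  refine (measureReal_mono ?_).trans (measureReal_union_le _ _)
  rintro ω ⟨hω, hω'⟩
  by_contra hcon
  simp only [Set.mem_union, Set.mem_ofPred_eq, not_or, not_and, not_le] at hcon
  have h1 := hcon.1 hω
  have h2 := hcon.2 hω
  have h3 := abs_sub_le (S.ffbsi T J s h ω) (S.ffbsm D s T h ω) (∫ x, h x ∂M.smoothing T s)
  linarith
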